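/- Let $P\subset\mathbb{R}^e$ be a polytope of dimension $d\ge 0$ and let $c$ be a linear function on $\mathbb{R}^e$ that takes distinct values at distinct vertices of $P$. For each nonempty face $F$ of $P$ let its apex $v_F$ be the vertex of $F$ at which $c$ attains its minimum over $F$. The pointed triangulation of $P$ with apexes $V(P)=\{v_F\}$ is $$\mathcal{C}_P=\{\emptyset\}\cup\big\{\operatorname{conv}\{v_{G_1},\dots,v_{G_k}\}\;:\;k\ge 1,\ G_1\supsetneq G_2\supsetneq\cdots\supsetneq G_k \text{ nonempty faces of } P,\ v_{G_i}\notin G_{i+1}\text{ for }1\le i<k\big\}.$$ Recall that a polytopal complex is a finite set of polytopes that contains $\emptyset$, contains every face of each of its members, and in which the intersection of any two members is a face of both; its facets are its inclusion-maximal members, and it is pure of dimension $d$ if all its facets have dimension $d$. A shelling of a pure $d$-dimensional polytopal complex is a linear ordering $F_1,\dots,F_s$ of its facets such that either $d=0$, or (1) the complex of proper faces of $F_1$ has a shelling, and (2) for every $j\ge 2$ the set $F_j\cap(F_1\cup\dots\cup F_{j-1})$ is nonempty and equals $F'_1\cup\dots\cup F'_r$ for some shelling $F'_1,\dots,F'_r,\dots,F'_{s'}$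 of the complex of proper faces of $F_j$. Then $\mathcal{C}_P$ is a triangulation of $P$, that is, a polytopal complex consisting of simplices whose union is $P$; it is pure of dimension $d$, and there is a shelling $\alpha_1,\dots,\alpha_s$ of $\mathcal{C}_P$ (an ordering of its $d$-simplices) such that for every $j\in\{2,\dots,s\}$ the number $l_j$ of facets of $\alpha_j$ contained in $\alpha_j\cap\bigcup_{i<j}\alpha_i$ satisfies $1\le l_j\le d-1$. -/

import Mathlib

namespace PointedTriangulation

section

variable {E : Type*} [NormedAddCommGroup E] [NormedSpace ℝ E]

/-- A polytope: the convex hull of a finite (possibly empty) set of points. -/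
def IsPolytope (P : Set E) : Prop :=
  ∃ t : Finset E, P = convexHull ℝ (t : Set E)

/-- `P` is nonempty and its affine hull has dimension `k`. (The empty set, which has
dimension `-1`, has no dimension `k : ℕ` in this sense.) -/
def HasDim (P : Set E) (k : ℕ) : Prop :=
  P.Nonempty ∧ Module.finrank ℝ (vectorSpan ℝ P) = k

/-- `F` is a face of `P`: either empty, or the set where some linear function attains its maximum
over `P`. In particular `∅` and `P` are faces of `P`. -/
def IsFace (P F : Set E) : Prop :=
  IsExposed ℝ P F

/-- A simplex: the convex hull of a finite (possibly empty) affinely independent set of points. -/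
def IsSimplex (S : Set E) : Prop :=
  ∃ t : Finset E, AffineIndependent ℝ ((↑) : t → E) ∧ S = convexHull ℝ (t : Set E)

/-- `F` is a facet of the `d`-polytope `P`, that is, a face of dimension `d - 1`. -/
def IsFacet (d : ℕ) (P F : Set E) : Prop :=
  IsFace P F ∧ ∃ k : ℕ, k + 1 = d ∧ HasDim F k

/-- A polytopal complex. -/
structure IsPolytopalComplex (C : Set (Set E)) : Prop where
  finite : C.Finite
  polytope : ∀ F ∈ C, IsPolytope F
  empty_mem : ∅ ∈ C
  face_mem : ∀ F ∈ C, ∀ G, IsFace F G → G ∈ C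
  inter_face : ∀ F ∈ C, ∀ G ∈ C, IsFace F (F ∩ G) ∧ IsFace G (F ∩ G)

/-- The facets of a complex: its inclusion-maximal members. -/
def complexFacets (C : Set (Set E)) : Set (Set E) :=
  {F | Maximal (· ∈ C) F}

/-- `C` is a pure polytopal complex of dimension `d`. -/
def IsPureComplex (d : ℕ) (C : Set (Set E)) : Prop :=
  IsPolytopalComplex C ∧ ∀ F ∈ complexFacets C, HasDim F d

/-- `C` is a triangulation of `P`: a polytopal complex of simplices with underlying set `P`. -/
def IsTriangulation (P : Set E) (C : Set (Set E)) : Prop :=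
  IsPolytopalComplex C ∧ (∀ S ∈ C, IsSimplex S) ∧ ⋃₀ C = P

/-- The boundary complex of a polytope: the complex of its proper faces. -/
def boundaryComplex (P : Set E) : Set (Set E) :=
  {F | IsFace P F ∧ F ≠ P}

/-- The intersection of the `j`-th member of a sequence of sets with the union of the earlier
members. -/
def earlierInter {s : ℕ} (α : Fin s → Set E) (j : Fin s) : Set E :=
  α j ∩ ⋃ i : Fin s, ⋃ _ : i < j, α i

/-- `α 0, …, α (s - 1)` is a shelling of the pure `d`-dimensional polytopal complex `C`:
a linear ordering of the facets of `C` such that either `d = 0`, or the boundary complex of the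
first facet has a shelling and the intersection of every later facet with the union of
the previous ones is nonempty and is the union of a beginning segment of a shelling of
the boundary complex of that facet. -/
def IsShelling : (d : ℕ) → (C : Set (Set E)) → (s : ℕ) → (α : Fin s → Set E) → Prop
  | 0, C, _, α =>
      IsPureComplex 0 C ∧ Function.Injective α ∧ Set.range α = complexFacets C
  | d + 1, C, s, α =>
      (IsPureComplex (d + 1) C ∧ Function.Injective α ∧ Set.range α = complexFacets C) ∧
      (∀ j : Fin s, (j : ℕ) = 0 →
        ∃ (s' : ℕ) (β : Fin s' → Set E), IsShelling d (boundaryComplex (α j)) s' β) ∧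
      (∀ j : Fin s, 0 < (j : ℕ) →
        (earlierInter α j).Nonempty ∧
        ∃ (s' : ℕ) (β : Fin s' → Set E), IsShelling d (boundaryComplex (α j)) s' β ∧
          ∃ r : ℕ, r ≤ s' ∧ earlierInter α j = ⋃ i : Fin s', ⋃ _ : (i : ℕ) < r, β i)

/-- The linear function `c` is in general position with respect to the polytope `P`: it takes
distinct values at distinct vertices of `P`. -/
def InGeneralPosition (c : E →L[ℝ] ℝ) (P : Set E) : Prop :=
  Set.InjOn c (P.extremePoints ℝ)

/-- `v` is the apex of the face `F` with respect to `c`: the vertex of `F` at which `c` attains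
its minimum over `F`. -/
def IsApex (c : E →L[ℝ] ℝ) (F : Set E) (v : E) : Prop :=
  v ∈ F.extremePoints ℝ ∧ ∀ y ∈ F, c v ≤ c y

/-- The pointed triangulation of `P` determined by `c`: the convex hulls of all sets of
apexes `v 0, …, v (k - 1)` of strictly decreasing chains `G 0 ⊋ ⋯ ⊋ G (k - 1)` of nonempty faces
of `P` such that no `v i` lies in the next face of the chain (equivalently, in
any later one). For `k = 0` this is the empty set. -/
def pointedTriangulation (c : E →L[ℝ] ℝ) (P : Set E) : Set (Set E) :=
  {S | ∃ (k : ℕ) (G : Fin k → Set E) (v : Fin k → E),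
      (∀ i, IsFace P (G i) ∧ (G i).Nonempty ∧ IsApex c (G i) (v i)) ∧
      (∀ i j, i < j → G j ⊂ G i ∧ v i ∉ G j) ∧
      S = convexHull ℝ (Set.range v)}

/-- The number of facets of the `d`-polytope `α j` that lie in the intersection of `α j` with the
union of the earlier `α i`. -/
noncomputable def overlapCount (d : ℕ) {s : ℕ} (α : Fin s → Set E) (j : Fin s) : ℕ :=
  {F : Set E | IsFacet d (α j) F ∧ F ⊆ earlierInter α j}.ncard

end

end PointedTriangulation

/-!
Following complete flags of faces and coning, at each face, its apex `v` with a maximal face that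
misses `v` yields the maximal simplices of the pointed triangulation. They form a regular
triangulation with heights `exp (-r * c)` for large `r`: if `v` is a vertex outside a flag `W`, then
among the vertices of `W` with nonzero barycentric coordinate at `v`, the one with the least value
of `c` is an apex `w` of the flag, its coordinate is positive, and `c w < c v`. Hence the affine
extension over `W` of the heights exceeds the height of `v`.

Order the maximal simplices of a regular triangulation of `P` by the values of their interpolated
height functions at a generic point `q` of `P`. A simplex then meets its predecessors exactly in its
facets visible from `q`, those opposite to the vertices at which `q` has a negative barycentric
coordinate. Since every ordering of the facets of a simplex shells its boundary, this is a shelling.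
Some facet is visible unless the simplex is the first. If all facets but one were visible, the
vertex opposite to the remaining one would be a convex combination of `q` and the other vertices,
contradicting its extremality in `P`.
-/

namespace PointedTriangulation

open Set

section Convex

variable {V : Type*} [AddCommGroup V] [Module ℝ V]

theorem nonneg_of_mem_hull {𝓕 : Type*} [FunLike 𝓕 V ℝ] [LinearMapClass 𝓕 ℝ V ℝ] {s : Set V}
    {l : 𝓕} (hl : ∀ a ∈ s, 0 ≤ l a) {z : V} (hz : z ∈ PointedCone.hull ℝ s) : 0 ≤ l z :=
  Submodule.span_le (p := (PointedCone.positive ℝ ℝ).comap (l : V →ₗ[ℝ] ℝ)).2 hl hz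

theorem hull_image {V' : Type*} [AddCommGroup V'] [Module ℝ V'] (f : V →ₗ[ℝ] V') (s : Set V) :
    PointedCone.hull ℝ (f '' s) = (PointedCone.hull ℝ s).map f :=
  (Submodule.map_span (f.restrictScalars {r : ℝ // 0 ≤ r}) s).symm

theorem exists_pos_add_smul_mem_of_mem_hull {P : Set V} (hP : Convex ℝ P) {y : V} (hy : y ∈ P)
    {z : V} (hz : z ∈ PointedCone.hull ℝ ((· - y) '' P)) : ∃ ε : ℝ, 0 < ε ∧ y + ε • z ∈ P := by
  induction hz using Submodule.span_induction with
  | mem z hz =>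
    obtain ⟨x, hx, rfl⟩ := hz
    exact ⟨1, one_pos, by simpa using hx⟩
  | zero => exact ⟨1, one_pos, by simpa using hy⟩
  | add z₁ z₂ _ _ h₁ h₂ =>
    obtain ⟨ε, hε, h₁⟩ := h₁
    obtain ⟨δ, hδ, h₂⟩ := h₂
    refine ⟨ε * δ / (ε + δ), by positivity, ?_⟩
    convert hP h₁ h₂ (a := δ / (ε + δ)) (b := ε / (ε + δ)) (by positivity) (by positivity)
      (by field_simp; ring) using 1
    match_scalars <;> field_simp
    ring
  | smul a z _ h =>
    obtain ⟨ε, hε, h⟩ := h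
    rcases eq_or_ne a 0 with rfl | ha
    · exact ⟨1, one_pos, by simpa using hy⟩
    have ha : 0 < (a : ℝ) := a.2.lt_of_ne' (by simpa [Subtype.ext_iff] using ha)
    refine ⟨ε / a, by positivity, ?_⟩
    convert h using 2
    change (ε / (a : ℝ)) • (a : ℝ) • z = ε • z
    rw [smul_smul, div_mul_cancel₀ _ ha.ne']

theorem le_of_mem_convexHull {𝓕 : Type*} [FunLike 𝓕 V ℝ] [LinearMapClass 𝓕 ℝ V ℝ] {s : Set V}
    {l : 𝓕} {M : ℝ} (h : ∀ u ∈ s, l u ≤ M) {x : V} (hx : x ∈ convexHull ℝ s) : l x ≤ M :=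
  convexHull_min (t := {x | l x ≤ M}) h (convex_halfSpace_le ⟨map_add l, map_smul l⟩ M) hx

theorem eq_convexHull_inter_of_isExtreme {t G : Set V} (hG : IsExtreme ℝ (convexHull ℝ t) G)
    (hconv : Convex ℝ G) : G = convexHull ℝ (t ∩ G) := by
  refine subset_antisymm (fun x hx => ?_) (convexHull_min inter_subset_right hconv)
  have hdiff : convexHull ℝ (t \ G) ⊆ convexHull ℝ t \ G :=
    convexHull_min (sdiff_subset_sdiff_left (subset_convexHull ℝ t))
      (hG.convex_sdiff (convex_convexHull ℝ t))
  have hxt := hG.subset hx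
  rw [← inter_union_sdiff t G] at hxt
  rcases (t ∩ G).eq_empty_or_nonempty with h₁ | h₁
  · rw [h₁, empty_union] at hxt
    exact absurd hx (hdiff hxt).2
  rcases (t \ G).eq_empty_or_nonempty with h₂ | h₂
  · rwa [h₂, union_empty] at hxt
  rw [convexHull_union h₁ h₂, mem_convexJoin] at hxt
  obtain ⟨a, ha, b, hb, hxab⟩ := hxt
  have haG : a ∈ G := convexHull_min inter_subset_right hconv ha
  have hxb : x ≠ b := ne_of_mem_of_not_mem hx (hdiff hb).2
  rcases eq_or_ne a x with rfl | hax
  · exact ha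
  · exact absurd (hG.right_mem_of_mem_openSegment (hG.subset haG) (hdiff hb).1 hx
      (mem_openSegment_of_ne_left_right hax hxb.symm hxab)) (hdiff hb).2

end Convex

variable {E : Type*} [NormedAddCommGroup E] [NormedSpace ℝ E]

-- Farkas' lemma. The induction step projects along the new generator onto the kernel of `l`.
theorem mem_hull_image_or_exists_separating {ι : Type*} (s : Finset ι) (a : ι → E) (b : E) :
    b ∈ PointedCone.hull ℝ (a '' s) ∨ ∃ l : E →L[ℝ] ℝ, (∀ i ∈ s, 0 ≤ l (a i)) ∧ l b < 0 := by
  classical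
  induction s using Finset.induction_on generalizing a b with
  | empty =>
    rcases eq_or_ne b 0 with rfl | hb
    · exact .inl (zero_mem _)
    · obtain ⟨l, hl⟩ := SeparatingDual.exists_eq_one (R := ℝ) hb
      exact .inr ⟨-l, by simp, by simp [hl]⟩
  | insert n s _ ih =>
    have hmono : PointedCone.hull ℝ (a '' s) ≤ PointedCone.hull ℝ (a '' (insert n s : Finset ι)) :=
      Submodule.span_mono (image_mono (by simp))
    rcases ih a b with hb | ⟨l, hl, hlb⟩
    · exact .inl (hmono hb)
    rcases le_or_gt 0 (l (a n)) with hln | hln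
    · exact .inr ⟨l, Finset.forall_mem_insert _ _ _ |>.2 ⟨hln, hl⟩, hlb⟩
    let π : E →L[ℝ] E := .id ℝ E - (l (a n))⁻¹ • l.smulRight (a n)
    have hπ (x : E) : π x = x - (l x / l (a n)) • a n := by
      simp [π, smul_smul, div_eq_inv_mul]
    rcases ih (π ∘ a) (π b) with hb | ⟨m, hm, hmb⟩
    · left
      rw [image_comp, ← ContinuousLinearMap.coe_coe π, hull_image, PointedCone.mem_map] at hb
      obtain ⟨z, hz, hzb⟩ := hb
      have hlz : 0 ≤ l z := nonneg_of_mem_hull (by simpa using hl) hz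
      have hcoeff : 0 ≤ (l b - l z) / l (a n) := div_nonneg_of_nonpos (by linarith) hln.le
      have hbz : b = z + ((l b - l z) / l (a n)) • a n := by
        simp only [ContinuousLinearMap.coe_coe, hπ] at hzb
        rw [sub_div, sub_smul, ← add_sub_assoc, add_sub_right_comm, hzb, sub_add_cancel]
      rw [hbz]
      exact add_mem (hmono hz) (PointedCone.smul_mem _ hcoeff
        (PointedCone.subset_hull (mem_image_of_mem a (by simp))))
    · refine .inr ⟨m.comp π, Finset.forall_mem_insert _ _ _ |>.2 ⟨?_, hm⟩, hmb⟩
      simp [hπ, div_self hln.ne]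

theorem exists_last_point_of_ray {P : Set E} (hP : IsCompact P) {v x : E} (hx : x ∈ P)
    (hxv : x ≠ v) :
    ∃ y ∈ P, x ∈ segment ℝ v y ∧ ∀ ε : ℝ, 0 < ε → y + ε • (y - v) ∉ P := by
  have hcompact : IsCompact (AffineMap.lineMap v x ⁻¹' P : Set ℝ) :=
    ((antilipschitzWith_lineMap hxv.symm).isClosedEmbedding
      (lipschitzWith_lineMap v x).uniformContinuous).isCompact_preimage hP
  have hone : (1 : ℝ) ∈ (AffineMap.lineMap v x ⁻¹' P : Set ℝ) := by simpa using hx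
  obtain ⟨s, hs, hmax⟩ := hcompact.exists_isGreatest ⟨1, hone⟩
  have hs1 : 1 ≤ s := hmax hone
  refine ⟨AffineMap.lineMap v x s, hs, ?_, fun ε hε hmem => ?_⟩
  · rw [segment_eq_image_lineMap]
    refine ⟨s⁻¹, ⟨by positivity, inv_le_one_of_one_le₀ hs1⟩, ?_⟩
    simp [AffineMap.lineMap_apply, smul_smul, inv_mul_cancel₀ (by positivity : s ≠ 0)]
  · have hnext : AffineMap.lineMap v x (s + ε * s) =
        AffineMap.lineMap v x s + ε • (AffineMap.lineMap v x s - v) := by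
      simp only [AffineMap.lineMap_apply, vsub_eq_sub, vadd_eq_add]
      module
    have hle : s + ε * s ≤ s := hmax (by rwa [mem_preimage, hnext])
    nlinarith

theorem IsPolytope.isCompact {P : Set E} (hP : IsPolytope P) : IsCompact P := by
  obtain ⟨t, rfl⟩ := hP
  exact t.finite_toSet.isCompact_convexHull ℝ

theorem IsPolytope.convex {P : Set E} (hP : IsPolytope P) : Convex ℝ P := by
  obtain ⟨t, rfl⟩ := hP
  exact convex_convexHull ℝ _

theorem isFace_sep_eq {P : Set E} {l : E →L[ℝ] ℝ} {M : ℝ} (hM : ∀ x ∈ P, l x ≤ M) :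
    IsFace P {x ∈ P | l x = M} := by
  rintro ⟨g, hgP, hg⟩
  exact ⟨l, Set.ext fun x => and_congr_right fun hx => ⟨fun hxM y hy => hxM ▸ hM y hy,
    fun hmax => (hM x hx).antisymm (hg ▸ hmax g hgP)⟩⟩

theorem IsFace.exists_eq_sep {P G : Set E} (h : IsFace P G) (hG : G.Nonempty) :
    ∃ (l : E →L[ℝ] ℝ) (M : ℝ), (∀ x ∈ P, l x ≤ M) ∧ G = {x ∈ P | l x = M} := by
  obtain ⟨l, rfl⟩ := h hG
  obtain ⟨g, hgP, hg⟩ := hG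
  exact ⟨l, l g, hg, Set.ext fun x => and_congr_right fun hx =>
    ⟨fun hmax => (hg x hx).antisymm (hmax g hgP), fun hxg y hy => hxg ▸ hg y hy⟩⟩

theorem IsPolytope.exists_isFace_of_ray {P : Set E} (hP : IsPolytope P) {v x : E} (hx : x ∈ P)
    (hxv : x ≠ v) : ∃ G, IsFace P G ∧ v ∉ G ∧ ∃ y ∈ G, x ∈ segment ℝ v y := by
  obtain ⟨y, hy, hxy, hlast⟩ := exists_last_point_of_ray hP.isCompact hx hxv
  obtain ⟨t, ht⟩ := id hP
  rcases mem_hull_image_or_exists_separating t (· - y) (y - v) with hmem | ⟨l, hl, hlv⟩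
  · have htP : (t : Set E) ⊆ P := ht ▸ subset_convexHull ℝ _
    obtain ⟨ε, hε, hεP⟩ := exists_pos_add_smul_mem_of_mem_hull hP.convex hy
      (Submodule.span_mono (image_mono htP) hmem)
    exact absurd hεP (hlast ε hε)
  · have hmax : ∀ x ∈ P, (-l) x ≤ (-l) y := fun x hx =>
      le_of_mem_convexHull (fun u hu => by simpa using hl u hu) (ht ▸ hx)
    refine ⟨_, isFace_sep_eq hmax, fun hv => ?_, y, ⟨hy, rfl⟩, hxy⟩
    have : l v = l y := by simpa using hv.2
    simp [this] at hlv

theorem IsFace.subset {P G : Set E} (h : IsFace P G) : G ⊆ P :=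
  IsExposed.subset h

theorem IsFace.isExtreme {P G : Set E} (h : IsFace P G) : IsExtreme ℝ P G :=
  IsExposed.isExtreme h

theorem IsFace.convex {P G : Set E} (h : IsFace P G) (hP : Convex ℝ P) : Convex ℝ G :=
  IsExposed.convex h hP

theorem IsFace.eq_convexHull_inter {t G : Set E} (h : IsFace (convexHull ℝ t) G) :
    G = convexHull ℝ (t ∩ G) :=
  eq_convexHull_inter_of_isExtreme h.isExtreme (h.convex (convex_convexHull ℝ t))

theorem IsFace.isPolytope {P G : Set E} (hP : IsPolytope P) (hG : IsFace P G) : IsPolytope G := by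
  classical
  obtain ⟨t, rfl⟩ := hP
  exact ⟨t.filter (· ∈ G), by simpa [inter_def] using hG.eq_convexHull_inter⟩

theorem IsPolytope.finite_setOf_isFace {P : Set E} (hP : IsPolytope P) :
    {G | IsFace P G}.Finite := by
  obtain ⟨t, rfl⟩ := hP
  refine (t.finite_toSet.finite_subsets.image (convexHull ℝ)).subset fun G hG => ?_
  exact ⟨↑t ∩ G, inter_subset_left, (IsFace.eq_convexHull_inter hG).symm⟩

theorem exists_forall_lt_mul {ι : Type*} (t : Finset ι) (f g : ι → ℝ) :
    ∃ r : ℝ, ∀ u ∈ t, 0 < f u → g u < r * f u := by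
  have h : ∀ᶠ r : ℝ in Filter.atTop, ∀ u ∈ t, 0 < f u → g u < r * f u := by
    simp only [Filter.eventually_all_finset, Filter.eventually_imp_distrib_left]
    exact fun u _ hu => (Filter.tendsto_id.atTop_mul_const hu).eventually_gt_atTop (g u)
  exact h.exists

theorem IsFace.trans {P F G : Set E} (hP : IsPolytope P) (hF : IsFace P F) (hG : IsFace F G) :
    IsFace P G := by
  obtain ⟨t, rfl⟩ := hP
  rcases G.eq_empty_or_nonempty with rfl | hGne
  · exact isExposed_empty
  obtain ⟨l, M, hM, hFl⟩ := hF.exists_eq_sep (hGne.mono hG.subset)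
  obtain ⟨m, N, hN, hGm⟩ := hG.exists_eq_sep hGne
  obtain ⟨r, hlt⟩ := exists_forall_lt_mul t (fun u => M - l u) (fun u => m u - N)
  have hval (x : E) : (r • l + m) x = r * l x + m x := by simp
  have hle : ∀ u ∈ t, (r • l + m) u ≤ r * M + N ∧ ((r • l + m) u = r * M + N → u ∈ G) := by
    intro u hu
    have hut := subset_convexHull ℝ (t : Set E) hu
    rw [hval]
    rcases (hM u hut).lt_or_eq with hu' | hu'
    · have := hlt u hu (sub_pos.2 hu')
      exact ⟨by linarith, fun he => by linarith⟩
    · have huF : u ∈ F := hFl ▸ ⟨hut, hu'⟩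
      have := hN u huF
      rw [hu']
      exact ⟨by linarith, fun he => hGm ▸ ⟨huF, by linarith⟩⟩
  have hface := isFace_sep_eq (fun x hx => le_of_mem_convexHull (fun u hu => (hle u hu).1) hx)
  convert hface using 1
  refine subset_antisymm (fun x hx => ?_) ?_
  · have hxF := hG.subset hx
    rw [hGm] at hx
    rw [hFl] at hxF
    exact ⟨hxF.1, by rw [hval, hxF.2, hx.2]⟩
  · rw [hface.eq_convexHull_inter]
    exact convexHull_min (fun u hu => (hle u hu.1).2 hu.2.2)
      (hG.convex (hF.convex (convex_convexHull ℝ _)))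

theorem IsPolytope.exists_continuousLinearMap_eqOn {P : Set E} (hP : IsPolytope P)
    (f : E →ₗ[ℝ] ℝ) : ∃ g : E →L[ℝ] ℝ, EqOn g f P := by
  obtain ⟨t, rfl⟩ := hP
  let V := Submodule.span ℝ (t : Set E)
  obtain ⟨g, hg⟩ := (SeparatingDual.dualMap_surjective_iff (f := V.subtype)).2
    V.injective_subtype (f.domRestrict V)
  exact ⟨g, fun x hx => DFunLike.congr_fun hg ⟨x, convexHull_min Submodule.subset_span V.convex hx⟩⟩

theorem exists_forall_mul_le {ι : Type*} {t : Finset ι} {f g : ι → ℝ}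
    (hf : ∀ u ∈ t, 0 ≤ f u) (hg : ∃ u ∈ t, 0 < g u) :
    ∃ s : ℝ, (∀ u ∈ t, s * g u ≤ f u) ∧ ∃ u ∈ t, 0 < g u ∧ s * g u = f u := by
  classical
  obtain ⟨u, hu, hmin⟩ := (t.filter (0 < g ·)).exists_min_image (fun u => f u / g u)
    (by simpa [Finset.Nonempty] using hg)
  simp only [Finset.mem_filter] at hu hmin
  refine ⟨f u / g u, fun u' hu' => ?_, u, hu.1, hu.2, div_mul_cancel₀ _ hu.2.ne'⟩
  rcases le_or_gt (g u') 0 with h | h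
  · exact (mul_nonpos_of_nonneg_of_nonpos (div_nonneg (hf u hu.1) hu.2.le) h).trans (hf u' hu')
  · exact (le_div_iff₀ h).1 (hmin u' ⟨hu', h⟩)

-- The hyperplane supporting `P` along `H` is rotated about the level set of `g` until it meets a
-- further generator of `P`.
theorem IsFace.exists_isFace_of_rotation {P H : Set E} (hP : IsPolytope P) (hH : IsFace P H)
    (hHne : H.Nonempty) {g : E →L[ℝ] ℝ} {γ : ℝ} (hg : ∀ x ∈ H, g x = γ) {u : E} (hu : u ∈ P)
    (hgu : γ < g u) :
    ∃ K, IsFace P K ∧ H ⊆ K ∧ (∃ x ∈ K, g x ≠ γ) ∧ ∀ x ∈ K, g x = γ → x ∈ H := by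
  obtain ⟨t, rfl⟩ := hP
  obtain ⟨l, M, hM, rfl⟩ := hH.exists_eq_sep hHne
  have hut {u : E} (hu : u ∈ t) := subset_convexHull ℝ (t : Set E) hu
  obtain ⟨u₀, hu₀, hgu₀⟩ : ∃ u₀ ∈ t, γ < g u₀ := by
    by_contra! h
    exact (le_of_mem_convexHull h hu).not_gt hgu
  obtain ⟨s, hle, u₁, hu₁, hgu₁, heq⟩ := exists_forall_mul_le (t := t)
    (f := fun u => M - l u) (g := fun u => g u - γ) (fun u hu => sub_nonneg.2 (hM u (hut hu)))
    ⟨u₀, hu₀, sub_pos.2 hgu₀⟩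
  have hval (x : E) : (l + s • g) x = l x + s * g x := by simp
  refine ⟨_, isFace_sep_eq (l := l + s • g) (M := M + s * γ)
    (fun x hx => le_of_mem_convexHull (fun u hu => ?_) hx), fun x hx => ⟨hx.1, ?_⟩,
    ⟨u₁, ⟨hut hu₁, ?_⟩, (sub_pos.1 hgu₁).ne'⟩, fun x hx hgx => ⟨hx.1, ?_⟩⟩
  · rw [hval]
    linarith [hle u hu]
  · rw [hval, hx.2, hg x hx]
  · rw [hval]
    linarith
  · have := hx.2
    rw [hval, hgx] at this
    linarith

theorem IsFace.exists_spanning {P G : Set E} (hP : IsPolytope P) (hG : IsFace P G)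
    (hGne : G.Nonempty) {v : E} (hv : v ∈ P) (hvG : v ∉ G) :
    ∃ H, IsFace P H ∧ G ⊆ H ∧ v ∉ H ∧ P ⊆ affineSpan ℝ (insert v H) := by
  have hfin : {H | IsFace P H ∧ v ∉ H}.Finite :=
    hP.finite_setOf_isFace.subset fun H hH => hH.1
  obtain ⟨H, hGH, hH⟩ := hfin.exists_le_maximal (a := G) ⟨hG, hvG⟩
  obtain ⟨hHP, hvH⟩ := hH.prop
  refine ⟨H, hHP, hGH, hvH, fun u hu => ?_⟩
  by_contra huA
  have hmem {x : E} (hx : x ∈ insert v H) := subset_affineSpan ℝ _ hx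
  have hdir : u -ᵥ v ∉ (affineSpan ℝ (insert v H)).direction := fun h =>
    huA (by simpa using AffineSubspace.vadd_mem_of_mem_direction h (hmem (mem_insert v H)))
  obtain ⟨f, hf, hker⟩ := Submodule.exists_le_ker_of_notMem hdir
  obtain ⟨f, hf, hfH⟩ : ∃ f : E →ₗ[ℝ] ℝ, f v < f u ∧ ∀ x ∈ H, f x = f v := by
    have hfH (x) (hx : x ∈ H) : f x = f v := sub_eq_zero.1 <| by
      simpa using hker (AffineSubspace.vsub_mem_direction (hmem (mem_insert_of_mem v hx))
        (hmem (mem_insert v H)))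
    rw [vsub_eq_sub, map_sub, sub_ne_zero] at hf
    rcases hf.lt_or_gt with h | h
    · exact ⟨-f, by simpa using h, by simpa using hfH⟩
    · exact ⟨f, h, hfH⟩
  obtain ⟨g, hg⟩ := hP.exists_continuousLinearMap_eqOn f
  obtain ⟨K, hK, hHK, ⟨x, hxK, hgx⟩, hKH⟩ := hHP.exists_isFace_of_rotation hP (hGne.mono hGH)
    (g := g) (fun x hx => (hg (hHP.subset hx)).trans ((hfH x hx).trans (hg hv).symm)) hu
    (by rwa [hg hv, hg hu])
  have hKle : K ⊆ H := hH.le_of_ge ⟨hK, fun hvK => hvH (hKH v hvK rfl)⟩ hHK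
  refine hgx ?_
  rw [hg (hK.subset hxK), hg hv, hfH x (hKle hxK)]

theorem IsPolytope.face_induction {motive : (P : Set E) → IsPolytope P → Prop}
    (ih : ∀ (P : Set E) (hP : IsPolytope P),
      (∀ (G : Set E) (hG : IsFace P G), G ≠ P → motive G (hG.isPolytope hP)) → motive P hP)
    {P : Set E} (hP : IsPolytope P) : motive P hP := by
  suffices h : ∀ (G : Set E) (hG : IsFace P G), motive G (hG.isPolytope hP) from
    h P (IsExposed.refl P)
  intro G hG
  refine (hP.finite_setOf_isFace.wellFoundedOn (r := (· ⊂ ·))).induction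
    (P := fun G => ∀ hG : IsFace P G, motive G (hG.isPolytope hP)) hG (fun G hG hlt _ => ?_) hG
  exact ih G (hG.isPolytope hP) fun K hK hne =>
    hlt K (hG.trans hP hK) (hK.subset.ssubset_of_ne hne) (hG.trans hP hK)

theorem IsPolytope.extremePoints_finite {P : Set E} (hP : IsPolytope P) :
    (P.extremePoints ℝ).Finite := by
  obtain ⟨t, rfl⟩ := hP
  exact t.finite_toSet.subset extremePoints_convexHull_subset

theorem IsFace.extremePoints_subset {P F : Set E} (hF : IsFace P F) :
    F.extremePoints ℝ ⊆ P.extremePoints ℝ :=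
  hF.isExtreme.extremePoints_subset_extremePoints

theorem IsApex.mem {c : E →L[ℝ] ℝ} {F : Set E} {v : E} (h : IsApex c F v) : v ∈ F :=
  h.1.1

theorem exists_isApex (c : E →L[ℝ] ℝ) {F : Set E} (hF : IsCompact F) (hne : F.Nonempty) :
    ∃ v, IsApex c F v := by
  have hmin : IsExposed ℝ F ((-c).toExposed F) := ContinuousLinearMap.toExposed.isExposed
  obtain ⟨x, hx, hxmin⟩ := hF.exists_isMinOn hne c.continuous.continuousOn
  obtain ⟨v, hv⟩ := (hmin.isCompact hF).extremePoints_nonempty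
    ⟨x, hx, fun y hy => neg_le_neg (hxmin hy)⟩
  exact ⟨v, IsFace.extremePoints_subset hmin hv, fun y hy => neg_le_neg_iff.1 (hv.1.2 y hy)⟩

theorem InGeneralPosition.face {c : E →L[ℝ] ℝ} {F G : Set E} (h : InGeneralPosition c F)
    (hG : IsFace F G) : InGeneralPosition c G :=
  h.mono hG.extremePoints_subset

theorem IsApex.lt {c : E →L[ℝ] ℝ} {F : Set E} {v u : E} (hc : InGeneralPosition c F)
    (hv : IsApex c F v) (hu : u ∈ F.extremePoints ℝ) (huv : u ≠ v) : c v < c u :=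
  (hv.2 u hu.1).lt_of_ne fun he => huv (hc hu hv.1 he.symm)

theorem IsApex.eq_of_mem {c : E →L[ℝ] ℝ} {F G : Set E} {v w : E} (hc : InGeneralPosition c F)
    (hv : IsApex c F v) (hG : IsFace F G) (hw : IsApex c G w) (hvG : v ∈ G) : w = v := by
  by_contra hne
  exact (hw.2 v hvG).not_gt (hv.lt hc (hG.extremePoints_subset hw.1) hne)

section Barycentric

variable {V : Type*} [AddCommGroup V] [Module ℝ V]

/-- Affine independence of a finite set of points. -/
abbrev AffInd (W : Finset V) : Prop :=
  AffineIndependent ℝ ((↑) : W → V)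

theorem AffInd.subset {U W : Finset V} (h : AffInd W) (hU : U ⊆ W) : AffInd U :=
  AffineIndependent.mono (s := (U : Set V)) (t := (W : Set V)) h (Finset.coe_subset.2 hU)

theorem AffInd.insert [DecidableEq V] {W : Finset V} (h : AffInd W) {v : V}
    (hv : v ∉ affineSpan ℝ (W : Set V)) : AffInd (insert v W) := by
  refine AffineIndependent.affineIndependent_of_notMem_span
    (i := ⟨v, Finset.mem_insert_self v W⟩) ?_ fun hmem => hv (affineSpan_mono ℝ ?_ hmem)
  · have hW (u : {u : (Insert.insert v W : Finset V) // u ≠ ⟨v, Finset.mem_insert_self v W⟩}) :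
        (u.1 : V) ∈ W :=
      Finset.mem_of_mem_insert_of_ne u.1.2 fun huv => u.2 (Subtype.ext huv)
    exact h.comp_embedding ⟨fun u => (⟨u.1, hW u⟩ : W), fun u u' huu' =>
      Subtype.ext (Subtype.ext (congrArg (fun w : W => (w : V)) huu'))⟩
  · rintro _ ⟨u, huv, rfl⟩
    exact Finset.mem_of_mem_insert_of_ne u.2 fun heq => huv (Subtype.ext heq)

theorem AffInd.exists_affineMap_eqOn {W : Finset V} (h : AffInd W) (y : V → ℝ) :
    ∃ f : V →ᵃ[ℝ] ℝ, EqOn f y W := by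
  classical
  obtain ⟨t, hWt, ht, hspan⟩ := exists_subset_affineIndependent_affineSpan_eq_top (k := ℝ)
    (s := (W : Set V)) h
  let B : AffineBasis t ℝ V := ⟨(↑), ht, by simpa using hspan⟩
  let g : (t → ℝ) →ₗ[ℝ] ℝ := ∑ u ∈ W.attach, y u • LinearMap.proj ⟨u, hWt u.2⟩
  refine ⟨g.toAffineMap.comp B.coords, fun w hw => ?_⟩
  have hcoord (u : W) : B.coord ⟨u, hWt u.2⟩ w = if u = ⟨w, hw⟩ then 1 else 0 :=
    (B.coord_apply ⟨u, hWt u.2⟩ ⟨w, hWt hw⟩).trans (by simp [Subtype.ext_iff])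
  simp [g, hcoord]

/-- An affine function with the prescribed values on `W`. It is determined only on the affine
span of `W`, and arbitrary if `W` is affinely dependent. -/
noncomputable def interpolant (y : V → ℝ) (W : Finset V) : V →ᵃ[ℝ] ℝ :=
  Classical.epsilon fun f => EqOn f y W

theorem AffInd.interpolant_eqOn {W : Finset V} (h : AffInd W) (y : V → ℝ) :
    EqOn (interpolant y W) y W :=
  Classical.epsilon_spec (h.exists_affineMap_eqOn y)

/-- The barycentric coordinate at the vertex `w` of the simplex with vertex set `W`, extended to an
affine function on the whole space. -/
noncomputable def bary (W : Finset V) (w : V) : V →ᵃ[ℝ] ℝ :=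
  interpolant (indicator {w} 1) W

theorem AffInd.bary_self {W : Finset V} (h : AffInd W) {w : V} (hw : w ∈ W) : bary W w w = 1 := by
  simp [bary, h.interpolant_eqOn _ hw]

theorem AffInd.bary_of_ne {W : Finset V} (h : AffInd W) {w u : V} (hu : u ∈ W) (huw : u ≠ w) :
    bary W w u = 0 := by
  simp [bary, h.interpolant_eqOn _ hu, huw]

theorem affineMap_sum_smul {W : Finset V} {a : V → ℝ} (ha : ∑ u ∈ W, a u = 1) (f : V →ᵃ[ℝ] ℝ) :
    f (∑ u ∈ W, a u • u) = ∑ u ∈ W, a u * f u := by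
  have := W.map_affineCombination id a ha f
  rwa [W.affineCombination_eq_linear_combination _ _ ha,
    W.affineCombination_eq_linear_combination _ _ ha] at this

theorem exists_sum_smul_eq_of_mem_affineSpan {W : Finset V} {x : V}
    (hx : x ∈ affineSpan ℝ (W : Set V)) :
    ∃ a : V → ℝ, ∑ u ∈ W, a u = 1 ∧ ∑ u ∈ W, a u • u = x := by
  obtain ⟨U, a, hU, ha, rfl⟩ :=
    eq_affineCombination_of_mem_affineSpan_image (p := id) (s := (W : Set V)) (by simpa using hx)
  have hsum : ∑ u ∈ W, indicator (U : Set V) a u = 1 := by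
    rw [Finset.sum_indicator_subset _ (Finset.coe_subset.1 hU), ha]
  refine ⟨indicator U a, hsum, ?_⟩
  rw [Finset.affineCombination_indicator_subset _ _ (Finset.coe_subset.1 hU),
    W.affineCombination_eq_linear_combination _ _ hsum]
  rfl

theorem AffInd.bary_sum_smul {W : Finset V} (h : AffInd W) {a : V → ℝ} (ha : ∑ u ∈ W, a u = 1)
    {w : V} (hw : w ∈ W) : bary W w (∑ u ∈ W, a u • u) = a w := by
  rw [affineMap_sum_smul ha, Finset.sum_eq_single_of_mem w hw, h.bary_self hw, mul_one]
  intro u hu huw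
  rw [h.bary_of_ne hu huw, mul_zero]

theorem AffInd.sum_bary {W : Finset V} (h : AffInd W) {x : V}
    (hx : x ∈ affineSpan ℝ (W : Set V)) : ∑ w ∈ W, bary W w x = 1 := by
  obtain ⟨a, ha, rfl⟩ := exists_sum_smul_eq_of_mem_affineSpan hx
  rw [← ha]
  exact Finset.sum_congr rfl fun w hw => h.bary_sum_smul ha hw

theorem AffInd.sum_bary_smul {W : Finset V} (h : AffInd W) {x : V}
    (hx : x ∈ affineSpan ℝ (W : Set V)) : ∑ w ∈ W, bary W w x • w = x := by
  obtain ⟨a, ha, rfl⟩ := exists_sum_smul_eq_of_mem_affineSpan hx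
  exact Finset.sum_congr rfl fun w hw => by rw [h.bary_sum_smul ha hw]

theorem AffInd.sum_bary_mul {W : Finset V} (h : AffInd W) (f : V →ᵃ[ℝ] ℝ) {x : V}
    (hx : x ∈ affineSpan ℝ (W : Set V)) : ∑ w ∈ W, bary W w x * f w = f x := by
  rw [← affineMap_sum_smul (h.sum_bary hx), h.sum_bary_smul hx]

theorem AffInd.bary_eq_of_subset {U W : Finset V} (h : AffInd W) (hU : U ⊆ W) {u x : V}
    (hu : u ∈ U) (hx : x ∈ affineSpan ℝ (U : Set V)) : bary W u x = bary U u x := by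
  refine AffineMap.eqOn_affineSpan (fun w hw => ?_) hx
  by_cases hwu : w = u
  · rw [hwu, h.bary_self (hU hu), (h.subset hU).bary_self hu]
  · rw [h.bary_of_ne (hU hw) hwu, (h.subset hU).bary_of_ne hw hwu]

theorem AffInd.bary_eq_zero_of_notMem {U W : Finset V} (h : AffInd W) (hU : U ⊆ W) {u x : V}
    (hu : u ∉ U) (hx : x ∈ affineSpan ℝ (U : Set V)) : bary W u x = 0 :=
  AffineMap.eqOn_affineSpan (f := bary W u) (g := 0)
    (fun _ hw => h.bary_of_ne (hU hw) (ne_of_mem_of_not_mem hw hu)) hx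

theorem AffInd.mem_convexHull_subset_iff {U W : Finset V} (h : AffInd W) (hU : U ⊆ W) {x : V}
    (hx : x ∈ affineSpan ℝ (W : Set V)) :
    x ∈ convexHull ℝ (U : Set V) ↔
      (∀ w ∈ W, 0 ≤ bary W w x) ∧ ∀ w ∈ W, w ∉ U → bary W w x = 0 := by
  constructor
  · intro hxU
    obtain ⟨a, ha₀, ha₁, rfl⟩ := Finset.mem_convexHull'.1 hxU
    have hsum : ∑ u ∈ W, indicator (U : Set V) a u = 1 := by
      rw [Finset.sum_indicator_subset _ hU, ha₁]
    have heq : ∑ u ∈ U, a u • u = ∑ u ∈ W, indicator (U : Set V) a u • u := by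
      simp only [← indicator_smul_left, Finset.sum_indicator_subset _ hU]
    rw [heq]
    refine ⟨fun w hw => ?_, fun w hw hwU => ?_⟩
    · rw [h.bary_sum_smul hsum hw]
      exact indicator_nonneg ha₀ w
    · rw [h.bary_sum_smul hsum hw, indicator_of_notMem (by simpa using hwU)]
  · rintro ⟨hnonneg, hzero⟩
    refine Finset.mem_convexHull'.2 ⟨fun w => bary W w x, fun w hw => hnonneg w (hU hw), ?_, ?_⟩
    · rw [Finset.sum_subset hU hzero, h.sum_bary hx]
    · rw [Finset.sum_subset hU fun w hw hwU => by simp only [hzero w hw hwU, zero_smul],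
        h.sum_bary_smul hx]

theorem AffInd.mem_convexHull_iff {W : Finset V} (h : AffInd W) {x : V}
    (hx : x ∈ affineSpan ℝ (W : Set V)) :
    x ∈ convexHull ℝ (W : Set V) ↔ ∀ w ∈ W, 0 ≤ bary W w x := by
  rw [h.mem_convexHull_subset_iff subset_rfl hx]
  exact and_iff_left fun w hw hwW => absurd hw hwW

theorem AffInd.bary_nonneg {W : Finset V} (h : AffInd W) {x w : V}
    (hx : x ∈ convexHull ℝ (W : Set V)) (hw : w ∈ W) : 0 ≤ bary W w x :=
  (h.mem_convexHull_iff (convexHull_subset_affineSpan _ hx)).1 hx w hw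

theorem AffInd.mem_convexHull_subset_iff_bary_eq_zero {U W : Finset V} (h : AffInd W) (hU : U ⊆ W)
    {x : V} (hx : x ∈ convexHull ℝ (W : Set V)) :
    x ∈ convexHull ℝ (U : Set V) ↔ ∀ w ∈ W, w ∉ U → bary W w x = 0 := by
  rw [h.mem_convexHull_subset_iff hU (convexHull_subset_affineSpan _ hx)]
  exact and_iff_right fun w => h.bary_nonneg hx

theorem AffInd.mem_convexHull_erase_iff [DecidableEq V] {W : Finset V} (h : AffInd W) {w x : V}
    (hw : w ∈ W) (hx : x ∈ convexHull ℝ (W : Set V)) :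
    x ∈ convexHull ℝ (W.erase w : Set V) ↔ bary W w x = 0 := by
  rw [h.mem_convexHull_subset_iff_bary_eq_zero (W.erase_subset w) hx]
  refine ⟨fun hzero => hzero w hw (W.notMem_erase w), fun hzero u hu huw => ?_⟩
  rwa [show u = w by simpa [hu] using huw]

theorem AffInd.convexHull_subset_iff {U U' W : Finset V} (h : AffInd W) (hU : U ⊆ W)
    (hU' : U' ⊆ W) : convexHull ℝ (U : Set V) ⊆ convexHull ℝ (U' : Set V) ↔ U ⊆ U' := by
  refine ⟨fun hs u hu => ?_, fun hs => convexHull_mono (Finset.coe_subset.2 hs)⟩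
  by_contra hn
  have hmem := subset_convexHull ℝ (W : Set V) (hU hu)
  have := (h.mem_convexHull_subset_iff_bary_eq_zero hU' hmem).1
    (hs (subset_convexHull ℝ _ hu)) u (hU hu) hn
  exact one_ne_zero ((h.bary_self (hU hu)).symm.trans this)

end Barycentric

theorem IsPolytope.isFace_sep_eq_zero {P : Set E} (hP : IsPolytope P) {f : E →ᵃ[ℝ] ℝ}
    (hf : ∀ x ∈ P, 0 ≤ f x) : IsFace P {x ∈ P | f x = 0} := by
  obtain ⟨g, hg⟩ := hP.exists_continuousLinearMap_eqOn (-f.linear)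
  have hgf {x : E} (hx : x ∈ P) : g x = f 0 - f x := by
    rw [hg hx, congrFun f.decomp x]
    simp
  convert isFace_sep_eq (l := g) (M := f 0) fun x hx => by linarith [hf x hx, hgf hx] using 1
  ext x
  refine and_congr_right fun hx => ?_
  rw [hgf hx, sub_eq_self]

theorem AffInd.isFace_erase [DecidableEq E] {W : Finset E} (h : AffInd W) {w : E} (hw : w ∈ W) :
    IsFace (convexHull ℝ (W : Set E)) (convexHull ℝ (W.erase w : Set E)) := by
  convert IsPolytope.isFace_sep_eq_zero ⟨W, rfl⟩ (f := bary W w) fun x hx => h.bary_nonneg hx hw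
    using 1
  ext x
  exact ⟨fun hx => have hxW := convexHull_mono (Finset.coe_subset.2 (W.erase_subset w)) hx
    ⟨hxW, (h.mem_convexHull_erase_iff hw hxW).1 hx⟩,
    fun hx => (h.mem_convexHull_erase_iff hw hx.1).2 hx.2⟩

theorem AffInd.isFace_of_subset {U W : Finset E} (h : AffInd W) (hU : U ⊆ W) :
    IsFace (convexHull ℝ (W : Set E)) (convexHull ℝ (U : Set E)) := by
  classical
  induction W using Finset.strongInduction with
  | H W ih =>
    rcases hU.eq_or_ssubset with rfl | hU
    · exact IsExposed.refl _
    obtain ⟨w, hw, hwU⟩ := Finset.exists_of_ssubset hU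
    exact (h.isFace_erase hw).trans ⟨W, rfl⟩ (ih _ (Finset.erase_ssubset hw)
      (h.subset (W.erase_subset w)) (Finset.subset_erase.2 ⟨hU.subset, hwU⟩))

theorem AffInd.isFace_iff {W : Finset E} (h : AffInd W) {F : Set E} :
    IsFace (convexHull ℝ (W : Set E)) F ↔ ∃ U ⊆ W, F = convexHull ℝ (U : Set E) := by
  classical
  constructor
  · intro hF
    exact ⟨W.filter (· ∈ F), W.filter_subset _, by simpa [inter_def] using hF.eq_convexHull_inter⟩
  · rintro ⟨U, hU, rfl⟩
    exact h.isFace_of_subset hU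

theorem AffInd.hasDim_iff {W : Finset E} (h : AffInd W) {k : ℕ} :
    HasDim (convexHull ℝ (W : Set E)) k ↔ W.card = k + 1 := by
  have hspan : vectorSpan ℝ (convexHull ℝ (W : Set E)) = vectorSpan ℝ (range ((↑) : W → E)) := by
    rw [← direction_affineSpan, affineSpan_convexHull, direction_affineSpan, Subtype.range_coe]
  rw [HasDim, hspan, convexHull_nonempty_iff]
  constructor
  · rintro ⟨hne, rfl⟩
    have : Nonempty W := hne.to_subtype
    rw [h.finrank_vectorSpan_add_one, Fintype.card_coe]
  · intro hcard
    exact ⟨Finset.card_pos.1 (by omega), h.finrank_vectorSpan (by simpa using hcard)⟩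

section PureFamily

variable {V : Type*} [AddCommGroup V] [Module ℝ V]

/-- The finite set `T` consists of the vertex sets of the maximal simplices of a nonempty pure
`d`-dimensional geometric simplicial complex. -/
structure IsPureFamily (d : ℕ) (T : Set (Finset V)) : Prop where
  finite : T.Finite
  nonempty : T.Nonempty
  affInd : ∀ W ∈ T, AffInd W
  card : ∀ W ∈ T, W.card = d + 1
  inter : ∀ W ∈ T, ∀ W' ∈ T,
    convexHull ℝ (W : Set V) ∩ convexHull ℝ (W' : Set V) ⊆ convexHull ℝ (W ∩ W' : Set V)

/-- The complex, with the empty simplex included, whose maximal simplices have the members of `T` as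
vertex sets. -/
def simplices (T : Set (Finset V)) : Set (Set V) :=
  (fun U : Finset V => convexHull ℝ (U : Set V)) '' lowerClosure T

namespace IsPureFamily

variable {d : ℕ} {T : Set (Finset V)} {U U' : Finset V}

theorem affInd_of_mem_lowerClosure (h : IsPureFamily d T) (hU : U ∈ lowerClosure T) :
    AffInd U := by
  obtain ⟨W, hW, hUW⟩ := hU
  exact (h.affInd W hW).subset hUW

theorem convexHull_inter (h : IsPureFamily d T) (hU : U ∈ lowerClosure T)
    (hU' : U' ∈ lowerClosure T) :
    convexHull ℝ (U : Set V) ∩ convexHull ℝ (U' : Set V) = convexHull ℝ (U ∩ U' : Set V) := by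
  classical
  obtain ⟨W, hW, hUW : U ⊆ W⟩ := hU
  obtain ⟨W', hW', hUW' : U' ⊆ W'⟩ := hU'
  refine Subset.antisymm (fun x hx => ?_)
    (subset_inter (convexHull_mono inter_subset_left) (convexHull_mono inter_subset_right))
  have hxWW' := h.inter W hW W' hW' ⟨convexHull_mono (Finset.coe_subset.2 hUW) hx.1,
    convexHull_mono (Finset.coe_subset.2 hUW') hx.2⟩
  rw [← Finset.coe_inter] at hxWW'
  have hxU : x ∈ convexHull ℝ ((U ∩ (W ∩ W') : Finset V) : Set V) := by
    rw [Finset.coe_inter, (h.affInd W hW).convexHull_inter hUW Finset.inter_subset_left]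
    exact ⟨hx.1, hxWW'⟩
  have hsub : U ∩ (W ∩ W') ⊆ W' := Finset.inter_subset_right.trans Finset.inter_subset_right
  have hxU' : x ∈ convexHull ℝ (((U ∩ (W ∩ W') : Finset V) : Set V) ∩ U') := by
    rw [(h.affInd W' hW').convexHull_inter hsub hUW']
    exact ⟨hxU, hx.2⟩
  exact convexHull_mono (inter_subset_inter_left _ (by simp)) hxU'

theorem convexHull_subset_iff (h : IsPureFamily d T) (hU : U ∈ lowerClosure T)
    (hU' : U' ∈ lowerClosure T) :
    convexHull ℝ (U : Set V) ⊆ convexHull ℝ (U' : Set V) ↔ U ⊆ U' := by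
  classical
  refine ⟨fun hsub => ?_, fun hsub => convexHull_mono (Finset.coe_subset.2 hsub)⟩
  rw [← inter_eq_left, h.convexHull_inter hU hU', ← Finset.coe_inter] at hsub
  exact (((h.affInd_of_mem_lowerClosure hU).convexHull_subset_iff subset_rfl
    Finset.inter_subset_left).1 hsub.ge).trans Finset.inter_subset_right

theorem injOn_convexHull (h : IsPureFamily d T) :
    InjOn (fun U : Finset V => convexHull ℝ (U : Set V)) T := fun _ hW _ hW' heq =>
  have hW := subset_lowerClosure hW
  have hW' := subset_lowerClosure hW'
  ((h.convexHull_subset_iff hW hW').1 heq.le).antisymm ((h.convexHull_subset_iff hW' hW).1 heq.ge)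

theorem maximal_mem_lowerClosure_iff (h : IsPureFamily d T) :
    Maximal (· ∈ lowerClosure T) U ↔ U ∈ T := by
  constructor
  · rintro ⟨⟨W, hW, hUW⟩, hmax⟩
    exact hUW.antisymm (hmax (subset_lowerClosure hW) hUW) ▸ hW
  · refine fun hU => ⟨subset_lowerClosure hU, ?_⟩
    rintro U' ⟨W, hW, hU'W⟩ hUU'
    rwa [Finset.eq_of_subset_of_card_le (hUU'.trans hU'W) (by rw [h.card W hW, h.card U hU])]

end IsPureFamily

end PureFamily

namespace IsPureFamily

variable {d : ℕ} {T : Set (Finset E)}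

theorem isPolytopalComplex (h : IsPureFamily d T) : IsPolytopalComplex (simplices T) where
  finite := by
    classical
    exact h.finite.lowerClosure.image _
  polytope := by
    rintro _ ⟨U, -, rfl⟩
    exact ⟨U, rfl⟩
  empty_mem := by
    obtain ⟨W, hW⟩ := h.nonempty
    exact ⟨∅, ⟨W, hW, W.empty_subset⟩, by simp⟩
  face_mem := by
    rintro _ ⟨U, hU, rfl⟩ G hG
    obtain ⟨U', hU', rfl⟩ := (h.affInd_of_mem_lowerClosure hU).isFace_iff.1 hG
    exact ⟨U', (lowerClosure T).lower hU' hU, rfl⟩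
  inter_face := by
    classical
    rintro _ ⟨U, hU, rfl⟩ _ ⟨U', hU', rfl⟩
    simp only [h.convexHull_inter hU hU', ← Finset.coe_inter]
    exact ⟨(h.affInd_of_mem_lowerClosure hU).isFace_of_subset Finset.inter_subset_left,
      (h.affInd_of_mem_lowerClosure hU').isFace_of_subset Finset.inter_subset_right⟩

theorem complexFacets_eq (h : IsPureFamily d T) :
    complexFacets (simplices T) = (fun U : Finset E => convexHull ℝ (U : Set E)) '' T := by
  refine Subset.antisymm ?_ ?_
  · rintro _ ⟨⟨U, hU, rfl⟩, hmax⟩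
    exact ⟨U, h.maximal_mem_lowerClosure_iff.1 ⟨hU, fun U' hU' hsub =>
      (h.convexHull_subset_iff hU' hU).1 (hmax ⟨U', hU', rfl⟩
        (convexHull_mono (Finset.coe_subset.2 hsub)))⟩, rfl⟩
  · rintro _ ⟨U, hU, rfl⟩
    obtain ⟨hU, hmax⟩ := h.maximal_mem_lowerClosure_iff.2 hU
    refine ⟨⟨U, hU, rfl⟩, ?_⟩
    rintro _ ⟨U', hU', rfl⟩ hsub
    exact (h.convexHull_subset_iff hU' hU).2 (hmax hU' ((h.convexHull_subset_iff hU hU').1 hsub))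

theorem enumerates_complexFacets (h : IsPureFamily d T) {s : ℕ} {a : Fin s → Finset E}
    (ha : Function.Injective a) (haT : range a = T) :
    Function.Injective (fun i => convexHull ℝ (a i : Set E)) ∧
      range (fun i => convexHull ℝ (a i : Set E)) = complexFacets (simplices T) := by
  subst haT
  exact ⟨fun i j hij => ha (h.injOn_convexHull (mem_range_self i) (mem_range_self j) hij),
    by rw [h.complexFacets_eq, ← range_comp, Function.comp_def]⟩

theorem isPureComplex (h : IsPureFamily d T) : IsPureComplex d (simplices T) := by
  refine ⟨h.isPolytopalComplex, ?_⟩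
  rw [h.complexFacets_eq]
  rintro _ ⟨W, hW, rfl⟩
  exact (h.affInd W hW).hasDim_iff.2 (h.card W hW)

theorem isTriangulation (h : IsPureFamily d T) :
    IsTriangulation (⋃ W ∈ T, convexHull ℝ (W : Set E)) (simplices T) := by
  refine ⟨h.isPolytopalComplex, ?_, Subset.antisymm (sUnion_subset ?_) ?_⟩
  · rintro _ ⟨U, hU, rfl⟩
    exact ⟨U, h.affInd_of_mem_lowerClosure hU, rfl⟩
  · rintro _ ⟨U, ⟨W, hW, hUW⟩, rfl⟩
    exact subset_iUnion₂_of_subset W hW (convexHull_mono (Finset.coe_subset.2 hUW))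
  · exact iUnion₂_subset fun W hW => subset_sUnion_of_mem ⟨W, subset_lowerClosure hW, rfl⟩

end IsPureFamily

section Boundary

variable [DecidableEq E] {W : Finset E}

theorem AffInd.injOn_convexHull_erase (h : AffInd W) :
    InjOn (fun w => convexHull ℝ (W.erase w : Set E)) W := fun v hv w _ hvw => by
  by_contra hne
  have hsub := (h.convexHull_subset_iff (W.erase_subset w) (W.erase_subset v)).1 hvw.ge
  exact W.notMem_erase v (hsub (Finset.mem_erase.2 ⟨hne, hv⟩))

theorem AffInd.convexHull_erase_inter (h : AffInd W) (v w : E) :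
    convexHull ℝ (W.erase v : Set E) ∩ convexHull ℝ (W.erase w : Set E) =
      convexHull ℝ ((W.erase v).erase w : Set E) := by
  rw [← h.convexHull_inter (W.erase_subset v) (W.erase_subset w), ← Finset.coe_inter,
    Finset.inter_erase, Finset.inter_eq_left.2 (W.erase_subset v)]

theorem AffInd.isPureFamily_erase (h : AffInd W) {n : ℕ} (hW : W.card = n + 2) :
    IsPureFamily n (W.erase '' W) where
  finite := W.finite_toSet.image _
  nonempty := (Finset.card_pos.1 (by omega : 0 < W.card)).to_set.image _
  affInd := by
    rintro _ ⟨w, -, rfl⟩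
    exact h.subset (W.erase_subset w)
  card := by
    rintro _ ⟨w, hw, rfl⟩
    rw [Finset.card_erase_of_mem hw, hW, Nat.add_succ_sub_one]
  inter := by
    rintro _ ⟨v, -, rfl⟩ _ ⟨w, -, rfl⟩
    exact (h.convexHull_inter (W.erase_subset v) (W.erase_subset w)).ge

theorem mem_lowerClosure_erase_iff {α : Type*} [DecidableEq α] {U W : Finset α} :
    U ∈ lowerClosure (W.erase '' (W : Set α)) ↔ U ⊂ W := by
  rw [Finset.ssubset_iff_exists_subset_erase]
  simp [mem_lowerClosure]

theorem AffInd.boundaryComplex_eq (h : AffInd W) :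
    boundaryComplex (convexHull ℝ (W : Set E)) = simplices (W.erase '' W) := by
  ext F
  constructor
  · rintro ⟨hF, hne⟩
    obtain ⟨U, hU, rfl⟩ := h.isFace_iff.1 hF
    exact ⟨U, mem_lowerClosure_erase_iff.2 (hU.ssubset_of_ne (by rintro rfl; exact hne rfl)), rfl⟩
  · rintro ⟨U, hU, rfl⟩
    have hUW := mem_lowerClosure_erase_iff.1 hU
    refine ⟨h.isFace_of_subset hUW.subset, fun heq => hUW.not_subset ?_⟩
    exact (h.convexHull_subset_iff subset_rfl hUW.subset).1 heq.ge

theorem injective_erase_comp {α : Type*} [DecidableEq α] {W : Finset α} {s : ℕ} {e : Fin s → α}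
    (he : Function.Injective e) (hrange : range e = W) :
    Function.Injective fun i => W.erase (e i) := fun i k hik =>
  he (Finset.erase_injOn W (hrange ▸ mem_range_self i) (hrange ▸ mem_range_self k) hik)

theorem exists_enumeration_subset_first {α : Type*} {V W : Finset α} (hV : V ⊆ W) :
    ∃ (n r : ℕ) (e : Fin n → α), r ≤ n ∧ Function.Injective e ∧ range e = W ∧
      ∀ i, e i ∈ V ↔ (i : ℕ) < r := by
  classical
  let eV (i : Fin V.card) : α := V.equivFin.symm i
  let eD (i : Fin (W \ V).card) : α := (W \ V).equivFin.symm i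
  have heV (i) : eV i ∈ V := Subtype.coe_prop _
  have heD (i) : eD i ∈ W \ V := Subtype.coe_prop _
  refine ⟨_, V.card, Fin.append eV eD, le_self_add, ?_, ?_, ?_⟩
  · refine Fin.append_injective_iff.2 ⟨Subtype.val_injective.comp (Equiv.injective _),
      Subtype.val_injective.comp (Equiv.injective _), fun i j hij => ?_⟩
    exact (Finset.mem_sdiff.1 (heD j)).2 (hij ▸ heV i)
  · ext x
    constructor
    · rintro ⟨i, rfl⟩
      refine Fin.addCases (fun i => ?_) (fun i => ?_) i
      · simpa using hV (heV i)
      · simpa using (Finset.mem_sdiff.1 (heD i)).1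
    · intro hx
      by_cases hxV : x ∈ V
      · exact ⟨Fin.castAdd _ (V.equivFin ⟨x, hxV⟩), by simp [eV]⟩
      · exact ⟨Fin.natAdd _ ((W \ V).equivFin ⟨x, Finset.mem_sdiff.2 ⟨hx, hxV⟩⟩), by simp [eD]⟩
  · refine Fin.addCases (fun i => ?_) (fun i => ?_)
    · simpa using heV i
    · simpa using (Finset.mem_sdiff.1 (heD i)).2

theorem AffInd.earlierInter_erase (h : AffInd W) {s : ℕ} (e : Fin s → E) (j : Fin s) :
    earlierInter (fun i => convexHull ℝ (W.erase (e i) : Set E)) j =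
      ⋃ w ∈ (Finset.Iio j).image e, convexHull ℝ ((W.erase (e j)).erase w : Set E) := by
  simp only [earlierInter, inter_iUnion, h.convexHull_erase_inter, Finset.set_biUnion_finset_image,
    Finset.mem_Iio]

theorem IsPureFamily.isShelling_succ {d : ℕ} {T : Set (Finset E)} (hT : IsPureFamily (d + 1) T)
    {s : ℕ} {a : Fin s → Finset E} (ha : Function.Injective a) (haT : range a = T)
    {V : Fin s → Finset E} (hV : ∀ j, V j ⊆ a j)
    (hVne : ∀ j : Fin s, 0 < (j : ℕ) → (V j).Nonempty)
    (hinter : ∀ j, earlierInter (fun i => convexHull ℝ (a i : Set E)) j =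
      ⋃ w ∈ V j, convexHull ℝ ((a j).erase w : Set E))
    (hboundary : ∀ W ∈ T, ∀ (n : ℕ) (e : Fin n → E), Function.Injective e → range e = W →
      IsShelling d (boundaryComplex (convexHull ℝ (W : Set E))) n
        fun i => convexHull ℝ (W.erase (e i) : Set E)) :
    IsShelling (d + 1) (simplices T) s fun i => convexHull ℝ (a i : Set E) := by
  have hmem (j) : a j ∈ T := haT ▸ mem_range_self j
  refine ⟨⟨hT.isPureComplex, hT.enumerates_complexFacets ha haT⟩, fun j _ => ?_, fun j hj => ?_⟩
  · obtain ⟨n, -, e, -, he, hrange, -⟩ := exists_enumeration_subset_first (hV j)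
    exact ⟨n, _, hboundary _ (hmem j) n e he hrange⟩
  · rw [hinter]
    obtain ⟨n, r, e, hr, he, hrange, heV⟩ := exists_enumeration_subset_first (hV j)
    refine ⟨?_, n, _, hboundary _ (hmem j) n e he hrange, r, hr, ?_⟩
    · obtain ⟨w, hw⟩ := hVne j hj
      have hpos : ((a j).erase w).Nonempty := by
        rw [← Finset.card_pos, Finset.card_erase_of_mem (hV j hw), hT.card _ (hmem j)]
        omega
      exact (convexHull_nonempty_iff.2 hpos.to_set).mono (subset_iUnion₂_of_subset w hw subset_rfl)
    · ext x
      simp only [mem_iUnion, exists_prop, ← heV]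
      refine ⟨?_, fun ⟨i, hi, hx⟩ => ⟨e i, hi, hx⟩⟩
      rintro ⟨w, hw, hx⟩
      obtain ⟨i, rfl⟩ : w ∈ range e := hrange ▸ hV j hw
      exact ⟨i, hw, hx⟩

theorem AffInd.isShelling_boundaryComplex {n : ℕ} (h : AffInd W) (hW : W.card = n + 2) {s : ℕ}
    {e : Fin s → E} (he : Function.Injective e) (hrange : range e = W) :
    IsShelling n (boundaryComplex (convexHull ℝ (W : Set E))) s
      fun i => convexHull ℝ (W.erase (e i) : Set E) := by
  induction n generalizing W s with
  | zero =>
    rw [h.boundaryComplex_eq]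
    have hfam := h.isPureFamily_erase hW
    exact ⟨hfam.isPureComplex, hfam.enumerates_complexFacets (injective_erase_comp he hrange)
      (by rw [← hrange, ← range_comp, Function.comp_def])⟩
  | succ n ih =>
    rw [h.boundaryComplex_eq]
    have hfam := h.isPureFamily_erase hW
    refine hfam.isShelling_succ (injective_erase_comp he hrange)
      (by rw [← hrange, ← range_comp, Function.comp_def]) (V := fun i => (Finset.Iio i).image e)
      (fun i => ?_) (fun i hi => ?_) (h.earlierInter_erase e)
      fun W' hW' n e he hrange => ih (hfam.affInd W' hW') (hfam.card W' hW') he hrange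
    · refine Finset.image_subset_iff.2 fun k hk => Finset.mem_erase.2 ⟨?_, ?_⟩
      · exact he.ne (Finset.mem_Iio.1 hk).ne
      · exact Finset.mem_coe.1 (hrange ▸ mem_range_self k)
    · exact ⟨_, Finset.mem_image_of_mem e (a := ⟨0, hi.trans i.2⟩)
        (Finset.mem_Iio.2 (Fin.lt_def.2 hi))⟩

theorem IsPureFamily.isShelling {d : ℕ} {T : Set (Finset E)} (hT : IsPureFamily d T)
    {s : ℕ} {a : Fin s → Finset E} (ha : Function.Injective a) (haT : range a = T)
    {V : Fin s → Finset E} (hV : ∀ j, V j ⊆ a j)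
    (hVne : ∀ j : Fin s, 0 < (j : ℕ) → (V j).Nonempty)
    (hinter : ∀ j, earlierInter (fun i => convexHull ℝ (a i : Set E)) j =
      ⋃ w ∈ V j, convexHull ℝ ((a j).erase w : Set E)) :
    IsShelling d (simplices T) s fun i => convexHull ℝ (a i : Set E) := by
  cases d with
  | zero => exact ⟨hT.isPureComplex, hT.enumerates_complexFacets ha haT⟩
  | succ d => exact hT.isShelling_succ ha haT hV hVne hinter fun W hW n e =>
      (hT.affInd W hW).isShelling_boundaryComplex (hT.card W hW)

end Boundary

section RegularTriangulation

open scoped Topology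

variable {V : Type*} [AddCommGroup V] [Module ℝ V]

theorem apply_lineMap_eq (f : V →ᵃ[ℝ] ℝ) (x y : V) (r : ℝ) :
    f (AffineMap.lineMap x y r) = (1 - r) * f x + r * f y := by
  rw [AffineMap.apply_lineMap, AffineMap.lineMap_apply_module, smul_eq_mul, smul_eq_mul]

theorem eventually_lineMap_pos (f : V →ᵃ[ℝ] ℝ) {x : V} (y : V) (hx : 0 < f x) :
    ∀ᶠ r : ℝ in 𝓝[>] 0, 0 < f (AffineMap.lineMap x y r) := by
  have hcont : Continuous fun r : ℝ => f (AffineMap.lineMap x y r) := by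
    simp only [apply_lineMap_eq]
    fun_prop
  exact nhdsWithin_le_nhds (hcont.continuousAt.eventually (lt_mem_nhds (by simpa using hx)))

theorem exists_forall_ne_zero {P : Set V} (hP : Convex ℝ P) (hne : P.Nonempty)
    {S : Set (V →ᵃ[ℝ] ℝ)} (hfin : S.Finite) (hS : ∀ f ∈ S, ∃ p ∈ P, f p ≠ 0) :
    ∃ q ∈ P, ∀ f ∈ S, f q ≠ 0 := by
  induction S, hfin using Set.Finite.induction_on with
  | empty => exact ⟨hne.some, hne.some_mem, by simp⟩
  | @insert f S _ hfin ih =>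
    obtain ⟨q, hq, hqS⟩ := ih fun g hg => hS g (mem_insert_of_mem f hg)
    by_cases hfq : f q = 0
    · obtain ⟨p, hp, hfp⟩ := hS f (mem_insert f S)
      have hne_zero : ∀ᶠ r : ℝ in 𝓝[>] 0, ∀ g ∈ S, g (AffineMap.lineMap q p r) ≠ 0 := by
        refine (Filter.eventually_all_finite hfin).2 fun g hg => ?_
        rcases (hqS g hg).lt_or_gt with hneg | hpos
        · filter_upwards [eventually_lineMap_pos (-g) p (x := q) (by simpa using hneg)] with r hr
          exact (neg_pos.1 hr).ne
        · filter_upwards [eventually_lineMap_pos g p hpos] with r hr using hr.ne'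
      obtain ⟨r, hr, hr₀, hr₁⟩ := (hne_zero.and (Ioo_mem_nhdsGT one_pos)).exists
      refine ⟨_, hP.lineMap_mem hq hp ⟨hr₀.le, hr₁.le⟩, forall_mem_insert.2 ⟨?_, hr⟩⟩
      rw [apply_lineMap_eq, hfq, mul_zero, zero_add]
      exact mul_ne_zero hr₀.ne' hfp
    · exact ⟨q, hq, forall_mem_insert.2 ⟨hfq, hqS⟩⟩

theorem AffInd.eventually_lineMap_mem_convexHull {W : Finset V} (h : AffInd W) {x q : V}
    (hx : x ∈ convexHull ℝ (W : Set V)) (hq : q ∈ affineSpan ℝ (W : Set V))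
    (hpos : ∀ w ∈ W, bary W w q < 0 → 0 < bary W w x) :
    ∀ᶠ r : ℝ in 𝓝[>] 0, AffineMap.lineMap x q r ∈ convexHull ℝ (W : Set V) := by
  have hnonneg : ∀ᶠ r : ℝ in 𝓝[>] 0, ∀ w ∈ W, 0 ≤ bary W w (AffineMap.lineMap x q r) := by
    refine W.eventually_all.2 fun w hw => ?_
    rcases lt_or_ge (bary W w q) 0 with hwq | hwq
    · filter_upwards [eventually_lineMap_pos (bary W w) q (hpos w hw hwq)] with r hr using hr.le
    · filter_upwards [Ioo_mem_nhdsGT one_pos] with r hr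
      rw [apply_lineMap_eq]
      exact add_nonneg (mul_nonneg (sub_nonneg.2 hr.2.le) (h.bary_nonneg hx hw))
        (mul_nonneg hr.1.le hwq)
  filter_upwards [hnonneg] with r hr
  exact (h.mem_convexHull_iff
    (AffineMap.lineMap_mem r (convexHull_subset_affineSpan _ hx) hq)).2 hr

theorem AffInd.exists_mem_convexHull_forall_subset {U W : Finset V} (h : AffInd W) (hU : U ⊆ W)
    (hne : U.Nonempty) :
    ∃ y ∈ convexHull ℝ (U : Set V), ∀ U' ⊆ W, y ∈ convexHull ℝ (U' : Set V) → U ⊆ U' := by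
  have hcard : (0 : ℝ) < (U.card : ℝ)⁻¹ := inv_pos.2 (by exact_mod_cast hne.card_pos)
  have hsum : ∑ _u ∈ U, (U.card : ℝ)⁻¹ = 1 := by
    rw [Finset.sum_const, nsmul_eq_mul, mul_inv_cancel₀ (inv_pos.1 hcard).ne']
  have hy : ∑ u ∈ U, (U.card : ℝ)⁻¹ • u ∈ convexHull ℝ (U : Set V) :=
    Finset.mem_convexHull'.2 ⟨fun _ => _, fun _ _ => hcard.le, hsum, rfl⟩
  refine ⟨_, hy, fun U' hU' hyU' u hu => ?_⟩
  by_contra huU'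
  have hzero := (h.mem_convexHull_subset_iff_bary_eq_zero hU'
    (convexHull_mono (Finset.coe_subset.2 hU) hy)).1 hyU' u (hU hu) huU'
  rw [affineMap_sum_smul hsum, Finset.sum_eq_single_of_mem u hu fun w hw hwu => by
    rw [h.bary_of_ne (hU hw) hwu, mul_zero], h.bary_self (hU hu), mul_one] at hzero
  exact hcard.ne' hzero

theorem AffInd.eq_of_bary_nonpos {P : Set V} (hP : Convex ℝ P) {W : Finset V} (h : AffInd W)
    (hWP : (W : Set V) ⊆ P) {w q : V} (hw : w ∈ W) (hext : w ∈ P.extremePoints ℝ) (hq : q ∈ P)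
    (hqW : q ∈ affineSpan ℝ (W : Set V)) (hle : ∀ u ∈ W, u ≠ w → bary W u q ≤ 0) : q = w := by
  classical
  by_contra hqw
  have hsum := h.sum_bary hqW
  have hcomb := h.sum_bary_smul hqW
  rw [← Finset.add_sum_erase _ _ hw] at hsum hcomb
  let a (u : V) : ℝ := if u = w then 1 else -bary W u q
  let z (u : V) : V := if u = w then q else u
  have ha_nonneg : ∀ u ∈ W, 0 ≤ a u := fun u hu => by
    by_cases huw : u = w
    · simp [a, huw]
    · simpa [a, huw] using hle u hu huw
  have hz_mem : ∀ u ∈ W, z u ∈ P \ {w} := fun u hu => by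
    by_cases huw : u = w
    · simpa [z, huw] using ⟨hq, hqw⟩
    · simpa [z, huw] using hWP hu
  have hz {u : V} (hu : u ∈ W.erase w) : a u = -bary W u q ∧ a u • z u = -(bary W u q • u) := by
    simp [a, z, Finset.ne_of_mem_erase hu]
  have ha_sum : ∑ u ∈ W, a u = bary W w q := by
    rw [← Finset.add_sum_erase _ _ hw, Finset.sum_congr rfl fun u hu => (hz hu).1,
      Finset.sum_neg_distrib, ← sub_eq_add_neg, sub_eq_iff_eq_add, hsum]
    simp [a]
  have hz_sum : ∑ u ∈ W, a u • z u = bary W w q • w := by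
    rw [← Finset.add_sum_erase _ _ hw, Finset.sum_congr rfl fun u hu => (hz hu).2,
      Finset.sum_neg_distrib, ← sub_eq_add_neg, sub_eq_iff_eq_add, hcomb]
    simp [a, z]
  have hpos : 0 < ∑ u ∈ W, a u :=
    Finset.sum_pos' ha_nonneg ⟨w, hw, by simp [a]⟩
  have hmem := (hP.mem_extremePoints_iff_convex_sdiff.1 hext).2.centerMass_mem ha_nonneg hpos hz_mem
  rw [Finset.centerMass, hz_sum, ha_sum, inv_smul_smul₀ (ha_sum ▸ hpos).ne'] at hmem
  exact hmem.2 rfl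

/-- The maximal simplices, given by their vertex sets, of a `d`-dimensional regular triangulation
of the convex set `P` without new vertices: the affine functions interpolating the heights `ht`
over the simplices lie strictly above the heights of all other vertices. -/
structure IsRegularTriangulation (P : Set V) (d : ℕ) (T : Set (Finset V)) (ht : V → ℝ) : Prop where
  finite : T.Finite
  convex : Convex ℝ P
  nonempty : P.Nonempty
  affInd : ∀ W ∈ T, AffInd W
  card : ∀ W ∈ T, W.card = d + 1
  subset_extremePoints : ∀ W ∈ T, (W : Set V) ⊆ P.extremePoints ℝ
  subset_affineSpan : ∀ W ∈ T, P ⊆ affineSpan ℝ (W : Set V)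
  cover : P ⊆ ⋃ W ∈ T, convexHull ℝ (W : Set V)
  lt : ∀ W ∈ T, ∀ W' ∈ T, ∀ v ∈ W', v ∉ W → ht v < interpolant ht W v

namespace IsRegularTriangulation

variable {P : Set V} {d : ℕ} {T : Set (Finset V)} {ht : V → ℝ} {W W' : Finset V} {q x : V}

theorem convexHull_subset (h : IsRegularTriangulation P d T ht) (hW : W ∈ T) :
    convexHull ℝ (W : Set V) ⊆ P :=
  convexHull_min ((h.subset_extremePoints W hW).trans extremePoints_subset) h.convex

theorem interpolant_vertex_le (h : IsRegularTriangulation P d T ht) (hW : W ∈ T) (hW' : W' ∈ T)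
    {v : V} (hv : v ∈ W') : interpolant ht W' v ≤ interpolant ht W v := by
  rw [(h.affInd W' hW').interpolant_eqOn ht hv]
  by_cases hvW : v ∈ W
  · rw [(h.affInd W hW).interpolant_eqOn ht hvW]
  · exact (h.lt W hW W' hW' v hv hvW).le

theorem interpolant_le (h : IsRegularTriangulation P d T ht) (hW : W ∈ T) (hW' : W' ∈ T)
    (hx : x ∈ convexHull ℝ (W' : Set V)) : interpolant ht W' x ≤ interpolant ht W x := by
  have hA := h.affInd W' hW'
  rw [← hA.sum_bary_mul _ (convexHull_subset_affineSpan _ hx),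
    ← hA.sum_bary_mul _ (convexHull_subset_affineSpan _ hx)]
  exact Finset.sum_le_sum fun v hv =>
    mul_le_mul_of_nonneg_left (h.interpolant_vertex_le hW hW' hv) (hA.bary_nonneg hx hv)

theorem mem_inter_of_interpolant_eq (h : IsRegularTriangulation P d T ht) (hW : W ∈ T)
    (hW' : W' ∈ T) (hx : x ∈ convexHull ℝ (W' : Set V))
    (heq : interpolant ht W' x = interpolant ht W x) :
    x ∈ convexHull ℝ (W' ∩ W : Set V) := by
  classical
  have hA := h.affInd W' hW'
  rw [← hA.sum_bary_mul _ (convexHull_subset_affineSpan _ hx),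
    ← hA.sum_bary_mul _ (convexHull_subset_affineSpan _ hx),
    Finset.sum_eq_sum_iff_of_le fun v hv =>
      mul_le_mul_of_nonneg_left (h.interpolant_vertex_le hW hW' hv) (hA.bary_nonneg hx hv)] at heq
  rw [← Finset.coe_inter, hA.mem_convexHull_subset_iff_bary_eq_zero Finset.inter_subset_left hx]
  intro v hv hvn
  have hlt := h.lt W hW W' hW' v hv fun hvW => hvn (Finset.mem_inter.2 ⟨hv, hvW⟩)
  rw [← (h.affInd W' hW').interpolant_eqOn ht hv] at hlt
  by_contra hne
  exact hlt.ne (mul_left_cancel₀ hne (heq v hv))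

theorem interpolant_lt (h : IsRegularTriangulation P d T ht) (hW : W ∈ T) (hW' : W' ∈ T)
    (hx : x ∈ convexHull ℝ (W' : Set V)) (hxW : x ∉ convexHull ℝ (W : Set V)) :
    interpolant ht W' x < interpolant ht W x :=
  (h.interpolant_le hW hW' hx).lt_of_ne fun heq => hxW
    (convexHull_mono inter_subset_right (h.mem_inter_of_interpolant_eq hW hW' hx heq))

theorem interpolant_eq (h : IsRegularTriangulation P d T ht) (hW : W ∈ T) (hW' : W' ∈ T)
    (hx : x ∈ convexHull ℝ (W : Set V)) (hx' : x ∈ convexHull ℝ (W' : Set V)) :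
    interpolant ht W x = interpolant ht W' x :=
  (h.interpolant_le hW' hW hx).antisymm (h.interpolant_le hW hW' hx')

theorem isPureFamily (h : IsRegularTriangulation P d T ht) : IsPureFamily d T where
  finite := h.finite
  nonempty := (nonempty_biUnion.1 (h.nonempty.mono h.cover)).imp fun _ => And.left
  affInd := h.affInd
  card := h.card
  inter _ hW _ hW' _ hx :=
    h.mem_inter_of_interpolant_eq hW' hW hx.1 (h.interpolant_eq hW hW' hx.1 hx.2)

theorem biUnion_convexHull_eq (h : IsRegularTriangulation P d T ht) :
    ⋃ W ∈ T, convexHull ℝ (W : Set V) = P :=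
  Subset.antisymm (iUnion₂_subset fun _ => h.convexHull_subset) h.cover

theorem exists_injOn_interpolant (h : IsRegularTriangulation P d T ht) :
    ∃ q ∈ P, InjOn (fun W => interpolant ht W q) T := by
  have hne_zero : ∀ f ∈ (fun p : Finset V × Finset V => interpolant ht p.1 - interpolant ht p.2) ''
      T.offDiag, ∃ p ∈ P, f p ≠ 0 := by
    rintro _ ⟨⟨W, W'⟩, ⟨hW, hW', hne⟩, rfl⟩
    have hnot : ¬ W' ⊆ W := fun hsub => hne
      (Finset.eq_of_subset_of_card_le hsub (by rw [h.card W hW, h.card W' hW'])).symm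
    obtain ⟨v, hv, hvW⟩ := Finset.not_subset.1 hnot
    refine ⟨v, extremePoints_subset (h.subset_extremePoints W' hW' hv), sub_ne_zero.2 ?_⟩
    rw [(h.affInd W' hW').interpolant_eqOn ht hv]
    exact (h.lt W hW W' hW' v hv hvW).ne'
  obtain ⟨q, hq, hqT⟩ :=
    exists_forall_ne_zero h.convex h.nonempty (h.finite.offDiag.image _) hne_zero
  refine ⟨q, hq, fun W hW W' hW' heq => ?_⟩
  by_contra hWW'
  exact hqT (interpolant ht W - interpolant ht W') ⟨(W, W'), ⟨hW, hW', hWW'⟩, rfl⟩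
    (sub_eq_zero.2 heq)

end IsRegularTriangulation

/-- The vertices of the simplex with vertex set `W` opposite to the facets visible from `q`. -/
noncomputable def visible (q : V) (W : Finset V) : Finset V :=
  W.filter fun w => bary W w q < 0

namespace IsRegularTriangulation

variable {P : Set V} {d : ℕ} {T : Set (Finset V)} {ht : V → ℝ} {W W' : Finset V} {q x : V}

-- Otherwise the segment from `x` to `q` starts inside the simplex `W`, whose interpolant is the
-- lower one there, although it is the higher one at `q` and both agree at `x`.
theorem exists_mem_visible_of_lt [DecidableEq V] (h : IsRegularTriangulation P d T ht)
    (hq : q ∈ P) (hW : W ∈ T) (hW' : W' ∈ T) (hlt : interpolant ht W' q < interpolant ht W q)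
    (hx : x ∈ convexHull ℝ (W : Set V)) (hx' : x ∈ convexHull ℝ (W' : Set V)) :
    ∃ w ∈ visible q W, x ∈ convexHull ℝ (W.erase w : Set V) := by
  by_contra! hcon
  have hA := h.affInd W hW
  have hpos : ∀ w ∈ W, bary W w q < 0 → 0 < bary W w x := fun w hw hwq =>
    (hA.bary_nonneg hx hw).lt_of_ne' fun hzero =>
      hcon w (Finset.mem_filter.2 ⟨hw, hwq⟩) ((hA.mem_convexHull_erase_iff hw hx).2 hzero)
  obtain ⟨r, hr, hr₀ : 0 < r⟩ := ((hA.eventually_lineMap_mem_convexHull hx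
    (h.subset_affineSpan W hW hq) hpos).and self_mem_nhdsWithin).exists
  have hle := h.interpolant_le hW' hW hr
  rw [apply_lineMap_eq, apply_lineMap_eq, h.interpolant_eq hW hW' hx hx'] at hle
  exact (mul_lt_mul_of_pos_left hlt hr₀).not_ge (le_of_add_le_add_left hle)

theorem visible_nonempty (h : IsRegularTriangulation P d T ht) (hq : q ∈ P) (hW : W ∈ T)
    (hW' : W' ∈ T) (hlt : interpolant ht W' q < interpolant ht W q) : (visible q W).Nonempty := by
  by_contra hempty
  rw [Finset.not_nonempty_iff_eq_empty, visible, Finset.filter_eq_empty_iff] at hempty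
  have hqW := ((h.affInd W hW).mem_convexHull_iff (h.subset_affineSpan W hW hq)).2
    fun w hw => not_lt.1 (hempty hw)
  exact (h.interpolant_le hW' hW hqW).not_gt hlt

-- If `w` were the only vertex of `W` not in `visible q W`, then `w` would be a convex combination
-- of `q` and the other vertices of `W`, so `w` could not be extreme in `P`.
theorem card_visible_lt (h : IsRegularTriangulation P d T ht) (hq : q ∈ P) (hW : W ∈ T)
    (hne : (visible q W).Nonempty) : (visible q W).card < d := by
  classical
  have hA := h.affInd W hW
  have hqW := h.subset_affineSpan W hW hq
  have hneg {v : V} (hv : v ∈ visible q W) : bary W v q < 0 := (Finset.mem_filter.1 hv).2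
  have hsub : visible q W ⊆ W := Finset.filter_subset _ _
  have hssub : visible q W ⊂ W := by
    refine hsub.ssubset_of_ne fun heq => ?_
    have := Finset.sum_nonpos fun w hw => (hneg (heq.symm ▸ hw : w ∈ visible q W)).le
    rw [hA.sum_bary hqW] at this
    exact this.not_gt one_pos
  by_contra! hcard
  obtain ⟨w, hw, hwV⟩ := Finset.exists_of_ssubset hssub
  have hV : visible q W = W.erase w := Finset.eq_of_subset_of_card_le
    (Finset.subset_erase.2 ⟨hsub, hwV⟩) (by rwa [Finset.card_erase_of_mem hw, h.card W hW])
  obtain rfl : q = w := hA.eq_of_bary_nonpos h.convex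
    ((h.subset_extremePoints W hW).trans extremePoints_subset) hw
    (h.subset_extremePoints W hW hw) hq hqW fun u hu huw =>
      (hneg (hV.symm ▸ Finset.mem_erase.2 ⟨huw, hu⟩)).le
  obtain ⟨v, hv⟩ := hne
  exact (hneg hv).ne (hA.bary_of_ne hw fun heq => hwV (heq ▸ hv))

end IsRegularTriangulation

end RegularTriangulation

section Visible

open scoped Topology

theorem exists_frequently_lineMap_mem {ι : Type*} {P : Set E} (hP : Convex ℝ P) {I : Set ι}
    (hI : I.Finite) {K : ι → Set E} (hK : ∀ i ∈ I, IsClosed (K i)) (hcover : P ⊆ ⋃ i ∈ I, K i)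
    {x y : E} (hx : x ∈ P) (hy : y ∈ P) :
    ∃ i ∈ I, x ∈ K i ∧ ∃ᶠ r : ℝ in 𝓝[>] 0, AffineMap.lineMap x y r ∈ K i := by
  have hfreq : ∃ i ∈ I, ∃ᶠ r : ℝ in 𝓝[>] 0, AffineMap.lineMap x y r ∈ K i := by
    by_contra! hcon
    obtain ⟨r, hr, hr₀, hr₁⟩ :=
      (((Filter.eventually_all_finite hI).2 hcon).and (Ioo_mem_nhdsGT one_pos)).exists
    obtain ⟨i, hi, hmem⟩ := mem_iUnion₂.1 (hcover (hP.lineMap_mem hx hy ⟨hr₀.le, hr₁.le⟩))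
    exact hr i hi hmem
  obtain ⟨i, hi, hfreq⟩ := hfreq
  have hlim : Filter.Tendsto (AffineMap.lineMap x y) (𝓝[>] (0 : ℝ)) (𝓝 x) := by
    refine Filter.Tendsto.mono_left ?_ nhdsWithin_le_nhds
    simpa using (AffineMap.lineMap_continuous (R := ℝ) (p := x) (q := y)).tendsto 0
  exact ⟨i, hi, (hK i hi).mem_of_frequently_of_tendsto hfreq hlim, hfreq⟩

theorem IsRegularTriangulation.exists_lt_of_mem_visible [DecidableEq E] {P : Set E} {d : ℕ}
    {T : Set (Finset E)} {ht : E → ℝ} {W : Finset E} {q : E}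
    (h : IsRegularTriangulation P d T ht) (hq : q ∈ P) (hW : W ∈ T) {w : E} (hw : w ∈ visible q W) :
    ∃ W' ∈ T, interpolant ht W' q < interpolant ht W q ∧ W.erase w ⊆ W' := by
  obtain ⟨hwW, hwq⟩ := Finset.mem_filter.1 hw
  have hA := h.affInd W hW
  have hne : (W.erase w).Nonempty := by
    refine Finset.nonempty_of_sum_ne_zero (f := fun u => bary W u q) ?_
    have := hA.sum_bary (h.subset_affineSpan W hW hq)
    rw [← Finset.add_sum_erase _ _ hwW] at this
    linarith
  obtain ⟨y, hy, hy_min⟩ := hA.exists_mem_convexHull_forall_subset (W.erase_subset w) hne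
  have hyW := convexHull_mono (𝕜 := ℝ) (Finset.coe_subset.2 (W.erase_subset w)) hy
  obtain ⟨W', hW', hyW', hfreq⟩ := exists_frequently_lineMap_mem h.convex h.finite
    (fun W _ => W.finite_toSet.isClosed_convexHull ℝ) h.cover (h.convexHull_subset hW hyW) hq
  obtain ⟨r, hr, hr₀ : 0 < r⟩ := (hfreq.and_eventually self_mem_nhdsWithin).exists
  have hrW : AffineMap.lineMap y q r ∉ convexHull ℝ (W : Set E) := fun hmem => by
    have hnonneg := hA.bary_nonneg hmem hwW
    rw [apply_lineMap_eq, (hA.mem_convexHull_erase_iff hwW hyW).1 hy, mul_zero, zero_add] at hnonneg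
    exact (mul_neg_of_pos_of_neg hr₀ hwq).not_ge hnonneg
  have hlt := h.interpolant_lt hW hW' hr hrW
  rw [apply_lineMap_eq, apply_lineMap_eq, h.interpolant_eq hW' hW hyW' hyW] at hlt
  refine ⟨W', hW', lt_of_mul_lt_mul_left (lt_of_add_lt_add_left hlt) hr₀.le, ?_⟩
  have hyWW' := h.isPureFamily.inter W hW W' hW' ⟨hyW, hyW'⟩
  rw [← Finset.coe_inter] at hyWW'
  exact (hy_min _ Finset.inter_subset_left hyWW').trans Finset.inter_subset_right

end Visible

theorem exists_sorted_enumeration {α : Type*} {T : Set α} (hT : T.Finite) {f : α → ℝ}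
    (hf : InjOn f T) :
    ∃ (s : ℕ) (a : Fin s → α), range a = T ∧ ∀ i j, f (a i) < f (a j) ↔ i < j := by
  let o := (hT.image f).toFinset.orderEmbOfFin rfl
  have ho : range o = f '' T := by
    rw [Finset.range_orderEmbOfFin, Finite.coe_toFinset]
  choose a haT hfa using fun i => ho.subset (mem_range_self i)
  refine ⟨_, a, Subset.antisymm (range_subset_iff.2 haT) fun x hx => ?_, fun i j => ?_⟩
  · obtain ⟨i, hi⟩ := ho.superset (mem_image_of_mem f hx)
    exact ⟨i, hf (haT i) hx ((hfa i).trans hi)⟩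
  · rw [hfa, hfa, OrderEmbedding.lt_iff_lt]

theorem AffInd.setOf_isFacet_subset_eq [DecidableEq E] {V W : Finset E} (h : AffInd W)
    (hV : V ⊆ W) {d : ℕ} (hd : W.card = d + 2) :
    {F : Set E | IsFacet (d + 1) (convexHull ℝ (W : Set E)) F ∧
        F ⊆ ⋃ w ∈ V, convexHull ℝ (W.erase w : Set E)} =
      (fun w => convexHull ℝ (W.erase w : Set E)) '' V := by
  refine Subset.antisymm ?_ ?_
  · rintro F ⟨⟨hF, k, hk, hdim⟩, hsub⟩
    obtain ⟨U, hU, rfl⟩ := h.isFace_iff.1 hF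
    have hcard := (h.subset hU).hasDim_iff.1 hdim
    obtain ⟨y, hy, hy_min⟩ :=
      h.exists_mem_convexHull_forall_subset hU (Finset.card_pos.1 (by omega))
    obtain ⟨w, hw, hyw⟩ := mem_iUnion₂.1 (hsub hy)
    refine ⟨w, hw, ?_⟩
    rw [Finset.eq_of_subset_of_card_le (hy_min _ (Finset.erase_subset w W) hyw)]
    rw [Finset.card_erase_of_mem (hV hw)]
    omega
  · rintro _ ⟨w, hw, rfl⟩
    have hdim : HasDim (convexHull ℝ (W.erase w : Set E)) d := by
      rw [(h.subset (Finset.erase_subset w W)).hasDim_iff, Finset.card_erase_of_mem (hV hw), hd]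
      rfl
    exact ⟨⟨h.isFace_of_subset (Finset.erase_subset w W), d, rfl, hdim⟩,
      subset_iUnion₂_of_subset w hw subset_rfl⟩

theorem AffInd.overlapCount_eq_card [DecidableEq E] {d s : ℕ} {α : Fin s → Set E} {j : Fin s}
    {V W : Finset E} (h : AffInd W) (hV : V ⊆ W) (hcard : W.card = d + 2)
    (hα : α j = convexHull ℝ (W : Set E))
    (hinter : earlierInter α j = ⋃ w ∈ V, convexHull ℝ (W.erase w : Set E)) :
    overlapCount (d + 1) α j = V.card := by
  rw [overlapCount, hinter, hα, h.setOf_isFacet_subset_eq hV hcard,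
    (h.injOn_convexHull_erase.mono (Finset.coe_subset.2 hV)).ncard_image, ncard_coe_finset]

namespace IsRegularTriangulation

variable {P : Set E} {d : ℕ} {T : Set (Finset E)} {ht : E → ℝ} {q : E}

theorem earlierInter_eq [DecidableEq E] (h : IsRegularTriangulation P d T ht) (hq : q ∈ P)
    {s : ℕ} {a : Fin s → Finset E} (haT : range a = T)
    (hlt : ∀ i j, interpolant ht (a i) q < interpolant ht (a j) q ↔ i < j) (j : Fin s) :
    earlierInter (fun i => convexHull ℝ (a i : Set E)) j =
      ⋃ w ∈ visible q (a j), convexHull ℝ ((a j).erase w : Set E) := by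
  have hmem (i : Fin s) : a i ∈ T := haT ▸ mem_range_self i
  ext x
  simp only [earlierInter, mem_inter_iff, mem_iUnion, exists_prop]
  constructor
  · rintro ⟨hx, i, hij, hxi⟩
    exact h.exists_mem_visible_of_lt hq (hmem j) (hmem i) ((hlt i j).2 hij) hx hxi
  · rintro ⟨w, hw, hx⟩
    obtain ⟨W', hW', hlt', hsub⟩ := h.exists_lt_of_mem_visible hq (hmem j) hw
    obtain ⟨i, rfl⟩ : W' ∈ range a := haT ▸ hW'
    exact ⟨convexHull_mono (Finset.coe_subset.2 (Finset.erase_subset w _)) hx,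
      i, (hlt i j).1 hlt', convexHull_mono (Finset.coe_subset.2 hsub) hx⟩

theorem exists_isShelling (h : IsRegularTriangulation P d T ht) :
    ∃ (s : ℕ) (α : Fin s → Set E), IsShelling d (simplices T) s α ∧
      ∀ j : Fin s, 0 < (j : ℕ) → 1 ≤ overlapCount d α j ∧ overlapCount d α j ≤ d - 1 := by
  classical
  obtain ⟨q, hq, hinj⟩ := h.exists_injOn_interpolant
  obtain ⟨s, a, haT, hlt⟩ := exists_sorted_enumeration h.finite hinj
  have hmem (i : Fin s) : a i ∈ T := haT ▸ mem_range_self i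
  have ha : Function.Injective a := .of_lt_imp_ne fun i j hij heq =>
    ((hlt i j).2 hij).ne (by rw [heq])
  have hinter := h.earlierInter_eq hq haT hlt
  have hV (j : Fin s) : visible q (a j) ⊆ a j := Finset.filter_subset _ _
  have hVne (j : Fin s) (hj : 0 < (j : ℕ)) : (visible q (a j)).Nonempty :=
    h.visible_nonempty hq (hmem j) (hmem ⟨0, hj.trans j.2⟩) ((hlt _ _).2 (Fin.lt_def.2 hj))
  refine ⟨s, _, h.isPureFamily.isShelling ha haT hV hVne hinter, fun j hj => ?_⟩
  have hlt_d := h.card_visible_lt hq (hmem j) (hVne j hj)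
  obtain ⟨n, rfl⟩ : ∃ n, d = n + 1 := Nat.exists_eq_succ_of_ne_zero (by omega)
  rw [(h.affInd _ (hmem j)).overlapCount_eq_card (hV j) (h.card _ (hmem j)) rfl (hinter j)]
  exact ⟨(hVne j hj).card_pos, Nat.le_of_lt_succ hlt_d⟩

end IsRegularTriangulation

theorem IsFace.exists_affineMap {P G : Set E} (hG : IsFace P G) (hGne : G.Nonempty) :
    ∃ f : E →ᵃ[ℝ] ℝ, (∀ x ∈ P, 0 ≤ f x) ∧ ∀ x ∈ P, f x = 0 ↔ x ∈ G := by
  obtain ⟨l, M, hM, rfl⟩ := hG.exists_eq_sep hGne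
  refine ⟨AffineMap.const ℝ E M - l.toAffineMap, fun x hx => sub_nonneg.2 (hM x hx),
    fun x hx => ?_⟩
  exact sub_eq_zero.trans (eq_comm.trans (and_iff_right hx).symm)

theorem IsFace.mem_of_mem_affineSpan {P G : Set E} (hG : IsFace P G) {x : E} (hx : x ∈ P)
    (hxG : x ∈ affineSpan ℝ G) : x ∈ G := by
  obtain ⟨f, -, hf⟩ := hG.exists_affineMap ((affineSpan_nonempty ℝ).1 ⟨x, hxG⟩)
  exact (hf x hx).1
    (AffineMap.eqOn_affineSpan (g := 0) (fun y hy => (hf y (hG.subset hy)).2 hy) hxG)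

open scoped Classical in
/-- `W` consists of the apexes of a complete flag of faces of `F`: each face of the flag does not
contain the apex of the preceding one, and spans the preceding one together with that apex. -/
inductive IsFlag (c : E →L[ℝ] ℝ) : Set E → Finset E → Prop
  | point (v : E) : IsFlag c {v} {v}
  | cone {F G : Set E} {v : E} {W : Finset E} (hG : IsFace F G) (hv : IsApex c F v) (hvG : v ∉ G)
      (hspan : F ⊆ affineSpan ℝ (insert v G)) (hW : IsFlag c G W) : IsFlag c F (insert v W)

namespace IsFlag

variable {c : E →L[ℝ] ℝ} {F : Set E} {W : Finset E}

theorem nonempty (h : IsFlag c F W) : W.Nonempty := by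
  cases h <;> simp

theorem subset_extremePoints (h : IsFlag c F W) : (W : Set E) ⊆ F.extremePoints ℝ := by
  classical
  induction h with
  | point v => simp
  | cone hG hv _ _ _ ih =>
    rw [Finset.coe_insert]
    exact insert_subset hv.1 (ih.trans hG.extremePoints_subset)

theorem subset (h : IsFlag c F W) : (W : Set E) ⊆ F :=
  h.subset_extremePoints.trans extremePoints_subset

theorem subset_affineSpan (h : IsFlag c F W) : F ⊆ affineSpan ℝ (W : Set E) := by
  classical
  induction h with
  | point v => simp
  | cone _ _ _ hspan _ ih =>
    refine hspan.trans (affineSpan_le.2 ?_)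
    rw [Finset.coe_insert]
    exact insert_subset (mem_affineSpan ℝ (mem_insert _ _))
      (ih.trans (affineSpan_mono ℝ (subset_insert _ _)))

theorem affineSpan_eq (h : IsFlag c F W) : affineSpan ℝ (W : Set E) = affineSpan ℝ F :=
  (affineSpan_mono ℝ h.subset).antisymm (affineSpan_le.2 h.subset_affineSpan)

theorem affInd (h : IsFlag c F W) : AffInd W := by
  classical
  induction h with
  | point v => exact affineIndependent_of_subsingleton ℝ _
  | cone hG hv hvG _ hW ih =>
    exact ih.insert fun hmem =>
      hvG (hG.mem_of_mem_affineSpan hv.mem (affineSpan_mono ℝ hW.subset hmem))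

theorem card (h : IsFlag c F W) {d : ℕ} (hd : HasDim F d) : W.card = d + 1 := by
  refine h.affInd.hasDim_iff.1 ⟨convexHull_nonempty_iff.2 h.nonempty, ?_⟩
  rw [← direction_affineSpan, affineSpan_convexHull, h.affineSpan_eq, direction_affineSpan]
  exact hd.2

end IsFlag

theorem IsApex.exists_isFace_forall_isFlag_insert [DecidableEq E] {c : E →L[ℝ] ℝ} {P G : Set E}
    {v : E} (hP : IsPolytope P) (hv : IsApex c P v) (hG : IsFace P G) (hGne : G.Nonempty)
    (hvG : v ∉ G) :
    ∃ H, IsFace P H ∧ H ≠ P ∧ G ⊆ H ∧ ∀ W, IsFlag c H W → IsFlag c P (insert v W) := by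
  obtain ⟨H, hH, hGH, hvH, hspan⟩ := hG.exists_spanning hP hGne hv.mem hvG
  refine ⟨H, hH, fun heq => hvH (heq ▸ hv.mem), hGH, fun W hW => ?_⟩
  convert hW.cone hH hv hvH hspan

theorem IsApex.exists_isFlag_mem {c : E →L[ℝ] ℝ} {P : Set E} (hP : IsPolytope P) {v x : E}
    (hv : IsApex c P v) (hx : x ∈ P) :
    ∃ W, IsFlag c P W ∧ v ∈ W ∧ x ∈ convexHull ℝ (W : Set E) := by
  classical
  induction hP using IsPolytope.face_induction generalizing v x with
  | ih P hP ih =>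
    by_cases hsing : P = {v}
    · refine ⟨{v}, hsing ▸ .point v, Finset.mem_singleton_self v, ?_⟩
      rwa [Finset.coe_singleton, convexHull_singleton, ← hsing]
    obtain ⟨z, hz, hzv, hxz⟩ : ∃ z ∈ P, z ≠ v ∧ x ∈ segment ℝ v z := by
      by_cases hxv : x = v
      · obtain ⟨z, hz, hzv⟩ : ∃ z ∈ P, z ≠ v := by
          by_contra! hcon
          exact hsing (eq_singleton_iff_unique_mem.2 ⟨hv.mem, hcon⟩)
        exact ⟨z, hz, hzv, hxv ▸ left_mem_segment ℝ v z⟩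
      · exact ⟨x, hx, hxv, right_mem_segment ℝ v x⟩
    obtain ⟨G, hG, hvG, y, hy, hzy⟩ := hP.exists_isFace_of_ray hz hzv
    obtain ⟨H, hH, hHP, hGH, hcone⟩ :=
      hv.exists_isFace_forall_isFlag_insert hP hG ⟨y, hy⟩ hvG
    obtain ⟨w, hw⟩ := exists_isApex c (hH.isPolytope hP).isCompact ⟨y, hGH hy⟩
    obtain ⟨W, hW, -, hyW⟩ := ih H hH hHP hw (hGH hy)
    refine ⟨_, hcone W hW, Finset.mem_insert_self v W, ?_⟩
    have hvW : v ∈ convexHull ℝ (insert v W : Set E) := subset_convexHull ℝ _ (mem_insert v _)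
    have hconv := convex_convexHull ℝ (insert v W : Set E)
    rw [Finset.coe_insert]
    exact hconv.segment_subset hvW
      (hconv.segment_subset hvW (convexHull_mono (subset_insert v _) hyW) hzy) hxz

theorem IsFlag.exists_superset {c : E →L[ℝ] ℝ} {P G : Set E} {W : Finset E} (hP : IsPolytope P)
    (hc : InGeneralPosition c P) (hG : IsFace P G) (hW : IsFlag c G W) :
    ∃ W', IsFlag c P W' ∧ W ⊆ W' := by
  classical
  induction hP using IsPolytope.face_induction generalizing G W with
  | ih P hP ih =>
    have hne {A : Set E} {U : Finset E} (hU : IsFlag c A U) : A.Nonempty :=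
      hU.nonempty.to_set.mono hU.subset
    obtain ⟨v, hv⟩ := exists_isApex c hP.isCompact ((hne hW).mono hG.subset)
    have insert_apex {A : Set E} {U : Finset E} (hA : IsFace P A) (hvA : v ∉ A)
        (hU : IsFlag c A U) : ∃ W', IsFlag c P W' ∧ insert v U ⊆ W' := by
      obtain ⟨H, hH, hHP, hAH, hcone⟩ :=
        hv.exists_isFace_forall_isFlag_insert hP hA (hne hU) hvA
      obtain ⟨W', hW', hUW'⟩ := ih H hH hHP (hc.face hH) (hA.mono hH.subset hAH) hU
      exact ⟨_, hcone W' hW', Finset.insert_subset_insert v hUW'⟩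
    by_cases hvG : v ∈ G
    · cases hW with
      | point u =>
        obtain rfl : v = u := hvG
        obtain ⟨W', hW', hvW', -⟩ := hv.exists_isFlag_mem hP hv.mem
        exact ⟨W', hW', Finset.singleton_subset_iff.2 hvW'⟩
      | cone hA hu huA _ hU =>
        obtain rfl := hv.eq_of_mem hc hG hu hvG
        convert insert_apex (hG.trans hP hA) huA hU
    · obtain ⟨W', hW', hsub⟩ := insert_apex hG hvG hW
      exact ⟨W', hW', (Finset.subset_insert v W).trans hsub⟩

/-- The vertices `v i` are the apexes of the faces `G i` of `P` in a chain as in the definition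
of the pointed triangulation. -/
def IsApexChain (c : E →L[ℝ] ℝ) (P : Set E) {k : ℕ} (G : Fin k → Set E) (v : Fin k → E) : Prop :=
  (∀ i, IsFace P (G i) ∧ (G i).Nonempty ∧ IsApex c (G i) (v i)) ∧
    ∀ i j, i < j → G j ⊂ G i ∧ v i ∉ G j

namespace IsApexChain

variable {c : E →L[ℝ] ℝ} {P A : Set E} {k : ℕ}

theorem tail {G : Fin (k + 1) → Set E} {v : Fin (k + 1) → E} (h : IsApexChain c P G v) :
    IsApexChain c P (Fin.tail G) (Fin.tail v) :=
  ⟨fun i => h.1 i.succ, fun i j hij => h.2 i.succ j.succ (Fin.succ_lt_succ_iff.2 hij)⟩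

theorem cons {G : Fin k → Set E} {v : Fin k → E} (hP : IsPolytope P) (hA : IsFace P A)
    (h : IsApexChain c A G v) {a : E} (ha : IsApex c P a) (haA : a ∉ A) :
    IsApexChain c P (Fin.cons P G : Fin (k + 1) → Set E) (Fin.cons a v : Fin (k + 1) → E) := by
  have hGA (i : Fin k) : G i ⊆ A := (h.1 i).1.subset
  refine ⟨Fin.cases ⟨IsExposed.refl P, ⟨a, ha.mem⟩, ha⟩ fun i =>
    ⟨hA.trans hP (h.1 i).1, (h.1 i).2⟩, fun i j hij => ?_⟩
  obtain ⟨j, rfl⟩ := Fin.exists_succ_eq.2 (Fin.ne_zero_of_lt hij)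
  cases i using Fin.cases with
  | zero => exact ⟨⟨(hGA j).trans hA.subset, fun hsub => haA (hGA j (hsub ha.mem))⟩,
      fun haG => haA (hGA j haG)⟩
  | succ i => exact h.2 i j (Fin.succ_lt_succ_iff.1 hij)

theorem exists_isFlag_head {G : Fin (k + 1) → Set E} {v : Fin (k + 1) → E} (hP : IsPolytope P)
    (hc : InGeneralPosition c P) (h : IsApexChain c P G v) :
    ∃ W, IsFlag c (G 0) W ∧ range v ⊆ (W : Set E) := by
  classical
  induction k with
  | zero =>
    obtain ⟨hG, -, hv⟩ := h.1 0
    obtain ⟨W, hW, hvW, -⟩ := hv.exists_isFlag_mem (hG.isPolytope hP) hv.mem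
    exact ⟨W, hW, range_subset_iff.2 (Fin.forall_fin_one.2 hvW)⟩
  | succ k ih =>
    obtain ⟨W, hW, hvW⟩ := ih h.tail
    obtain ⟨⟨hG, -, hv⟩, hG₁, hne₁, -⟩ := And.intro (h.1 0) (h.1 1)
    obtain ⟨hlt, hvG₁⟩ := h.2 0 1 Fin.zero_lt_one
    have hG₁' : IsFace (G 0) (G 1) := hG₁.mono hG.subset hlt.subset
    obtain ⟨H, hH, -, hGH, hcone⟩ :=
      hv.exists_isFace_forall_isFlag_insert (hG.isPolytope hP) hG₁' hne₁ hvG₁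
    obtain ⟨W', hW', hWW'⟩ := hW.exists_superset (hH.isPolytope (hG.isPolytope hP))
      ((hc.face hG).face hH) (hG₁'.mono hH.subset hGH)
    refine ⟨_, hcone W' hW', ?_⟩
    rw [← Fin.cons_self_tail v, Fin.range_cons, Finset.coe_insert]
    exact insert_subset_insert (hvW.trans (Finset.coe_subset.2 hWW'))

theorem exists_isFlag {G : Fin k → Set E} {v : Fin k → E} (hP : IsPolytope P) (hne : P.Nonempty)
    (hc : InGeneralPosition c P) (h : IsApexChain c P G v) :
    ∃ W, IsFlag c P W ∧ range v ⊆ (W : Set E) := by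
  cases k with
  | zero =>
    obtain ⟨a, ha⟩ := exists_isApex c hP.isCompact hne
    obtain ⟨W, hW, -⟩ := ha.exists_isFlag_mem hP ha.mem
    exact ⟨W, hW, range_subset_iff.2 finZeroElim⟩
  | succ k =>
    obtain ⟨W, hW, hvW⟩ := h.exists_isFlag_head hP hc
    obtain ⟨W', hW', hWW'⟩ := hW.exists_superset hP hc (h.1 0).1
    exact ⟨W', hW', hvW.trans (Finset.coe_subset.2 hWW')⟩

end IsApexChain

theorem IsFlag.exists_isApexChain {c : E →L[ℝ] ℝ} {P : Set E} {U W : Finset E}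
    (hP : IsPolytope P) (hW : IsFlag c P W) (hU : U ⊆ W) :
    ∃ (k : ℕ) (G : Fin k → Set E) (v : Fin k → E), IsApexChain c P G v ∧ range v = U := by
  classical
  have nil (A : Set E) : IsApexChain c A (finZeroElim : Fin 0 → Set E) finZeroElim :=
    ⟨finZeroElim, finZeroElim⟩
  induction hW generalizing U with
  | point u =>
    rcases Finset.subset_singleton_iff.1 hU with rfl | rfl
    · exact ⟨0, _, _, nil {u}, by simp⟩
    · exact ⟨1, _, _, (nil ∅).cons hP isExposed_empty (a := u) ⟨by simp, by simp⟩
        (notMem_empty u), by simp⟩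
  | @cone F A a W hA ha haA _ _ ih =>
    obtain ⟨k, G, v, hchain, hrange⟩ :=
      ih (hA.isPolytope hP) (U := U.erase a) (by convert Finset.subset_insert_iff.1 hU)
    by_cases haU : a ∈ U
    · refine ⟨k + 1, _, _, hchain.cons hP hA ha haA, ?_⟩
      rw [Fin.range_cons, hrange, ← Finset.coe_insert, Finset.insert_erase haU]
    · rw [Finset.erase_eq_of_notMem haU] at hrange
      exact ⟨k, G, v, ⟨fun i => ⟨hA.trans hP (hchain.1 i).1, (hchain.1 i).2⟩, hchain.2⟩, hrange⟩

theorem pointedTriangulation_eq_simplices {c : E →L[ℝ] ℝ} {P : Set E} (hP : IsPolytope P)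
    (hne : P.Nonempty) (hc : InGeneralPosition c P) :
    pointedTriangulation c P = simplices {W | IsFlag c P W} := by
  classical
  refine Subset.antisymm ?_ ?_
  · rintro _ ⟨k, G, v, hG, hlt, rfl⟩
    obtain ⟨W, hW, hvW⟩ := IsApexChain.exists_isFlag hP hne hc ⟨hG, hlt⟩
    refine ⟨Finset.univ.image v, ⟨W, hW, ?_⟩, by simp⟩
    rwa [← Finset.coe_subset, Finset.coe_image, Finset.coe_univ, image_univ]
  · rintro _ ⟨U, ⟨W, hW, hUW⟩, rfl⟩
    obtain ⟨k, G, v, ⟨hG, hlt⟩, hrange⟩ := IsFlag.exists_isApexChain hP hW hUW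
    exact ⟨k, G, v, hG, hlt, by rw [hrange]⟩

theorem IsFlag.exists_bary_pos {c : E →L[ℝ] ℝ} {F : Set E} {W : Finset E} (h : IsFlag c F W)
    (hc : InGeneralPosition c F) {v : E} (hv : v ∈ F.extremePoints ℝ) (hvW : v ∉ W) :
    ∃ w ∈ W, c w < c v ∧ 0 < bary W w v ∧ ∀ u ∈ W, c u < c w → bary W u v = 0 := by
  classical
  induction h with
  | point u => exact absurd (by simpa using hv) hvW
  | @cone F G a W hG ha haG hspan hW ih =>
    have haW : a ∉ W := fun hmem => haG (hW.subset hmem)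
    have hflag : IsFlag c F (insert a W) := hW.cone hG ha haG hspan
    have hsub : W ⊆ insert a W := Finset.subset_insert a W
    by_cases hvG : v ∈ G
    · have hvspan : v ∈ affineSpan ℝ (W : Set E) := hW.subset_affineSpan hvG
      obtain ⟨w, hw, hwv, hpos, hzero⟩ := ih (hc.face hG)
        (inter_extremePoints_subset_extremePoints_of_subset hG.subset ⟨hvG, hv⟩)
        fun hmem => hvW (hsub hmem)
      refine ⟨w, hsub hw, hwv, ?_,
        Finset.forall_mem_insert _ _ _ |>.2 ⟨fun _ => ?_, fun u hu => ?_⟩⟩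
      · rwa [hflag.affInd.bary_eq_of_subset hsub hw hvspan]
      · exact hflag.affInd.bary_eq_zero_of_notMem hsub haW hvspan
      · rw [hflag.affInd.bary_eq_of_subset hsub hu hvspan]
        exact hzero u hu
    · refine ⟨a, Finset.mem_insert_self a W, ha.lt hc hv ?_, ?_, fun u hu hua => ?_⟩
      · rintro rfl
        exact hvW (Finset.mem_insert_self _ W)
      · obtain ⟨f, hf, hfG⟩ := hG.exists_affineMap (hW.nonempty.to_set.mono hW.subset)
        have hfv : f v = bary (insert a W) a v * f a := by
          rw [← hflag.affInd.sum_bary_mul f (hflag.subset_affineSpan hv.1),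
            Finset.sum_insert haW, Finset.sum_eq_zero, add_zero]
          intro u hu
          rw [(hfG u (hG.subset (hW.subset hu))).2 (hW.subset hu), mul_zero]
        have hpos {x : E} (hx : x ∈ F) (hxG : x ∉ G) : 0 < f x :=
          (hf x hx).lt_of_ne' fun h0 => hxG ((hfG x hx).1 h0)
        exact pos_of_mul_pos_left (hfv ▸ hpos hv.1 hvG) (hf a ha.mem)
      · exact absurd (ha.2 u (hflag.subset hu)) hua.not_ge

theorem eventually_exp_lt_sum_mul_exp {ι : Type*} {W : Finset ι} {c μ : ι → ℝ} (hc : InjOn c W)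
    {w : ι} (hw : w ∈ W) (hpos : 0 < μ w) (hzero : ∀ u ∈ W, c u < c w → μ u = 0) {a : ℝ}
    (ha : c w < a) :
    ∀ᶠ r : ℝ in Filter.atTop, Real.exp (-(r * a)) < ∑ u ∈ W, μ u * Real.exp (-(r * c u)) := by
  classical
  have hexp {b : ℝ} (hb : c w < b) :
      Filter.Tendsto (fun r : ℝ => Real.exp (-(r * (b - c w)))) Filter.atTop (nhds 0) :=
    Real.tendsto_exp_neg_atTop_nhds_zero.comp (Filter.tendsto_id.atTop_mul_const (sub_pos.2 hb))
  have hlim : Filter.Tendsto (fun r : ℝ => ∑ u ∈ W, μ u * Real.exp (-(r * (c u - c w))))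
      Filter.atTop (nhds (∑ u ∈ W, if u = w then μ w else 0)) := by
    refine tendsto_finsetSum _ fun u hu => ?_
    split_ifs with huw
    · simp [huw]
    · rcases (hc.ne hu hw huw).lt_or_gt with hlt | hgt
      · simp [hzero u hu hlt]
      · simpa using (hexp hgt).const_mul (μ u)
  rw [Finset.sum_ite_eq' W w, if_pos hw] at hlim
  filter_upwards [(hexp ha).eventually_lt hlim hpos] with r hr
  have factor (b : ℝ) :
      Real.exp (-(r * b)) = Real.exp (-(r * c w)) * Real.exp (-(r * (b - c w))) := by
    rw [← Real.exp_add]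
    ring_nf
  calc Real.exp (-(r * a)) = Real.exp (-(r * c w)) * Real.exp (-(r * (a - c w))) := factor a
    _ < Real.exp (-(r * c w)) * ∑ u ∈ W, μ u * Real.exp (-(r * (c u - c w))) :=
      mul_lt_mul_of_pos_left hr (Real.exp_pos _)
    _ = ∑ u ∈ W, μ u * Real.exp (-(r * c u)) := by
      rw [Finset.mul_sum]
      exact Finset.sum_congr rfl fun u _ => by rw [factor (c u), mul_left_comm]

theorem IsFlag.eventually_lt_interpolant {c : E →L[ℝ] ℝ} {F : Set E} {W : Finset E}
    (h : IsFlag c F W) (hc : InGeneralPosition c F) {v : E} (hv : v ∈ F.extremePoints ℝ)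
    (hvW : v ∉ W) :
    ∀ᶠ r : ℝ in Filter.atTop,
      Real.exp (-(r * c v)) < interpolant (fun u => Real.exp (-(r * c u))) W v := by
  obtain ⟨w, hw, hwv, hpos, hzero⟩ := h.exists_bary_pos hc hv hvW
  filter_upwards [eventually_exp_lt_sum_mul_exp (μ := fun u => bary W u v)
    (hc.mono h.subset_extremePoints) hw hpos hzero hwv] with r hr
  refine hr.trans_eq ?_
  rw [← h.affInd.sum_bary_mul _ (h.subset_affineSpan hv.1)]
  exact Finset.sum_congr rfl fun u hu => by rw [h.affInd.interpolant_eqOn _ hu]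

theorem IsPolytope.finite_setOf_isFlag {P : Set E} (hP : IsPolytope P) (c : E →L[ℝ] ℝ) :
    {W | IsFlag c P W}.Finite :=
  (hP.extremePoints_finite.finite_subsets.preimage Finset.coe_injective.injOn).subset
    fun _ hW => hW.subset_extremePoints

theorem exists_isRegularTriangulation {c : E →L[ℝ] ℝ} {P : Set E} {d : ℕ} (hP : IsPolytope P)
    (hd : HasDim P d) (hc : InGeneralPosition c P) :
    ∃ ht, IsRegularTriangulation P d {W | IsFlag c P W} ht := by
  have hfin := hP.finite_setOf_isFlag c
  have hlt : ∀ᶠ r : ℝ in Filter.atTop, ∀ W ∈ {W | IsFlag c P W}, ∀ W' ∈ {W | IsFlag c P W},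
      ∀ v ∈ W', v ∉ W →
        Real.exp (-(r * c v)) < interpolant (fun u => Real.exp (-(r * c u))) W v := by
    refine (Filter.eventually_all_finite hfin).2 fun W hW =>
      (Filter.eventually_all_finite hfin).2 fun W' hW' =>
        (Filter.eventually_all_finset W').2 fun v hv => ?_
    by_cases hvW : v ∈ W
    · exact .of_forall fun _ hn => absurd hvW hn
    · exact (hW.eventually_lt_interpolant hc (hW'.subset_extremePoints hv) hvW).mono
        fun _ hr _ => hr
  obtain ⟨r, hr⟩ := hlt.exists
  obtain ⟨v, hv⟩ := exists_isApex c hP.isCompact hd.1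
  refine ⟨_, hfin, hP.convex, hd.1, fun W hW => hW.affInd, fun W hW => hW.card hd,
    fun W hW => hW.subset_extremePoints, fun W hW => hW.subset_affineSpan, fun x hx => ?_, hr⟩
  obtain ⟨W, hW, -, hxW⟩ := hv.exists_isFlag_mem hP hx
  exact mem_biUnion (show W ∈ {W | IsFlag c P W} from hW) hxW

end PointedTriangulation

open PointedTriangulation in
theorem mainTheorem3_general {E : Type*} [NormedAddCommGroup E] [NormedSpace ℝ E] {d : ℕ}
    {P : Set E} (hP : IsPolytope P) (hd : HasDim P d) {c : E →L[ℝ] ℝ}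
    (hc : InGeneralPosition c P) :
    IsTriangulation P (pointedTriangulation c P) ∧
    ∃ (s : ℕ) (α : Fin s → Set E), IsShelling d (pointedTriangulation c P) s α ∧
      ∀ j : Fin s, 0 < (j : ℕ) → 1 ≤ overlapCount d α j ∧ overlapCount d α j ≤ d - 1 := by
  obtain ⟨ht, h⟩ := exists_isRegularTriangulation hP hd hc
  rw [pointedTriangulation_eq_simplices hP hd.1 hc]
  have htri := h.isPureFamily.isTriangulation
  rw [h.biUnion_convexHull_eq] at htri
  exact ⟨htri, h.exists_isShelling⟩

theorem mainTheorem3 {e d : ℕ} (P : Set (EuclideanSpace ℝ (Fin e)))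
    (hP : PointedTriangulation.IsPolytope P) (hd : PointedTriangulation.HasDim P d)
    (c : EuclideanSpace ℝ (Fin e) →L[ℝ] ℝ)
    (hc : PointedTriangulation.InGeneralPosition c P) :
    PointedTriangulation.IsTriangulation P (PointedTriangulation.pointedTriangulation c P) ∧
    ∃ (s : ℕ) (α : Fin s → Set (EuclideanSpace ℝ (Fin e))),
      PointedTriangulation.IsShelling d (PointedTriangulation.pointedTriangulation c P) s α ∧
      ∀ j : Fin s, 0 < (j : ℕ) →
        1 ≤ PointedTriangulation.overlapCount d α j ∧
        PointedTriangulation.overlapCount d α j ≤ d - 1 :=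
  mainTheorem3_general hP hd hc
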